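/- Let $n\ge 0$ and let $B$ be an $n$-category freely generated by a set $I$ of $n$-cells: for $n>0$ this means that $B$ is a free extension, generated by $I$, of its $(n-1)$-st truncation; for $n=0$ it means that $I$ is the set of all $0$-cells. An extension of $B$ is an $(n+1)$-category whose $n$-th truncation is $B$. An extension $X$ is freely generated by $J\subseteq X_{n+1}$ if for every extension $Y$ of $B$ and every map $\varphi:J\to Y_{n+1}$ with $d\varphi x=dx$ and $c\varphi x=cx$ there is a unique $\omega$-functor $X\to Y$ that is the identity on the cells of $B$ and extends $\varphi$. The elements of $I$ and $J$ are called indets. An $(n+1)$-cell $u$ of an extension is many-to-one if $cu\in I$. Every $n$-cell $w$ of $B$ is denoted by a term built from indets $x\in I$, identities $1_a$ and compositions $\bullet_k$ ($k<n$). Fix for each $w$ such a term $t_w$; let $|w|$ be the finite set of the places of $t_w$ at which an indet occurs, and let $\langle w\rangle:|w|\to I$ give the indet at each place. For $r\in|w|$ with $\langle w\rangle(r)=x$, and a cell $v$ of an extension, of dimension $n$ or $n+1$, such that, if $n>0$, $d^{(n-1)}v=dx$ and $c^{(n-1)}v=cx$, let $w\,\square_r\,v$ be the cell obtained by putting $v$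 in the place $r$ of $t_w$ (when $\dim v=n+1$, the composition of $v$ with an $n$-cell $y$ is composition with $1_y$). For $n$-cells $v$, fix a proof, in the equational logic of $\omega$-categories, that the term obtained from $t_w$ by putting $t_v$ in the place $r$ equals $t_{w\square_r v}$; it identifies $|w\,\square_r\,v|$ with $(|w|\setminus\{r\})\sqcup|v|$. For an extension $X$ of $B$, the multicategory $\mathbb C_X$ has object set $I$; its arrows are the many-to-one $(n+1)$-cells $u$ of $X$, with source $\langle du\rangle$ and target $cu$; multicomposition is placed composition $u\circ_r v=u\bullet_n(du\,\square_r\,v)$, defined when $cv=\langle du\rangle(r)$, where $|d(u\circ_r v)|=(|du|\setminus\{r\})\sqcup|dv|$ by the identification above; the identity arrow of $x\in I$ is $1_x$. A morphism of multicategories $\chi:\mathbb C_X\to\mathbb C_Z$ consists of a map on objects, a map on arrows, and bijections $\theta_u$ from the index set of the source of $u$ to that of $\chi u$, which are compatible with sources, targets and identity arrows and satisfy $\chi(u\circ_r v)=\chi u\circ_{\theta_u r}\chi v$ and $\theta_{u\circ_r v}=\theta_u|_{|du|\setminus\{r\}}\sqcup\theta_v$. Let $X$ be an extension of $B$ freely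 generated by a set $J$ of many-to-one $(n+1)$-cells, let $Z$ be any extension of $B$, and let $\chi:\mathbb C_X\to\mathbb C_Z$ be a morphism of multicategories that is the identity on objects and satisfies, for every $f\in J$, $d\chi f=df$, $c\chi f=cf$ and $\theta_f=\mathrm{id}_{|df|}$. Then there is a unique $\omega$-functor $F:X\to Z$ that is the identity on the cells of $B$ and satisfies $Fu=\chi u$ for every many-to-one $(n+1)$-cell $u$ of $X$. If, moreover, $Z$ is also freely generated, as an extension of $B$, by a set of many-to-one $(n+1)$-cells, and $\chi$ is an isomorphism, then $F$ is an isomorphism. -/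

import Mathlib

universe u

namespace Computad

/-! ### Strict higher categories -/

/-- The operations of an `ω`-category: a set of `k`-cells for every `k`, domain and codomain,
identity cells and the compositions `•_k`.  The partial operation `•_k` on `m`-cells is recorded as
the function `comp k`, of which only the values at `k < m` and at `k`-composable pairs mean anything:
no law and no notion below looks at the other values. -/
structure PreCat : Type (u + 1) where
  cell : ℕ → Type u
  d : ∀ {k : ℕ}, cell (k + 1) → cell k
  c : ∀ {k : ℕ}, cell (k + 1) → cell k
  one : ∀ {k : ℕ}, cell k → cell (k + 1)
  comp : ∀ {m : ℕ} (_k : ℕ), cell m → cell m → cell m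

namespace PreCat

variable (B : PreCat.{u})

/-- The iterated domain `d^{(k)} x` of an `m`-cell, for `k ≤ m`. -/
def dIter {k m : ℕ} (h : k ≤ m) (x : B.cell m) : B.cell k :=
  Nat.decreasingInduction (motive := fun j _ => B.cell j) (fun _ _ y => B.d y) x h

/-- The iterated codomain `c^{(k)} x` of an `m`-cell, for `k ≤ m`. -/
def cIter {k m : ℕ} (h : k ≤ m) (x : B.cell m) : B.cell k :=
  Nat.decreasingInduction (motive := fun j _ => B.cell j) (fun _ _ y => B.c y) x h

/-- The iterated identity `1_a^{(m)}` of a `k`-cell, for `k ≤ m`. -/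
def oneIter {k m : ℕ} (h : k ≤ m) (a : B.cell k) : B.cell m :=
  Nat.leRecOn (C := B.cell) h (fun {_} y => B.one y) a

/-- Parallel cells; any two `0`-cells are parallel. -/
def Parallel : ∀ {n : ℕ}, B.cell n → B.cell n → Prop
  | 0, _, _ => True
  | _ + 1, x, y => B.d x = B.d y ∧ B.c x = B.c y

/-- The cells of the form `1_a`; there are none in dimension `0`. -/
def IsOne : ∀ {n : ℕ}, B.cell n → Prop
  | 0, _ => False
  | _ + 1, x => ∃ a, B.one a = x

/-- `d^{(k)} x = c^{(k)} y` for `n`-cells, `k ≤ n`. -/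
def Composable {n k : ℕ} (hk : k ≤ n) (x y : B.cell n) : Prop :=
  B.dIter hk x = B.cIter hk y

end PreCat

/-- Operations of a layer of `(n+1)`-cells lying over the cells of dimension `≤ n` of `B`. -/
structure Layer (B : PreCat.{u}) (n : ℕ) : Type (u + 1) where
  Top : Type u
  d : Top → B.cell n
  c : Top → B.cell n
  one : B.cell n → Top
  /-- `comp k` is `•_k`, for `k ≤ n`. -/
  comp : ℕ → Top → Top → Top

namespace Layer

variable {B : PreCat.{u}} {n : ℕ}

/-- The composite `x •_k y` of `(n+1)`-cells is defined: `d^{(k)} x = c^{(k)} y`. -/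
def Composable (X : Layer B n) {k : ℕ} (hk : k ≤ n) (x y : X.Top) : Prop :=
  B.dIter hk (X.d x) = B.cIter hk (X.c y)

/-- The axioms of strict higher categories, for the `(n+1)`-cells. -/
structure Lawful (X : Layer B n) : Prop where
  parallel : ∀ x, B.Parallel (X.d x) (X.c x)
  d_one : ∀ a, X.d (X.one a) = a
  c_one : ∀ a, X.c (X.one a) = a
  d_comp_top : ∀ x y, X.Composable le_rfl x y → X.d (X.comp n x y) = X.d y
  c_comp_top : ∀ x y, X.Composable le_rfl x y → X.c (X.comp n x y) = X.c x
  d_comp : ∀ {k} (hk : k < n) x y, X.Composable hk.le x y →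
    X.d (X.comp k x y) = B.comp k (X.d x) (X.d y)
  c_comp : ∀ {k} (hk : k < n) x y, X.Composable hk.le x y →
    X.c (X.comp k x y) = B.comp k (X.c x) (X.c y)
  assoc : ∀ {k} (hk : k ≤ n) x y z, X.Composable hk x y → X.Composable hk y z →
    X.comp k (X.comp k x y) z = X.comp k x (X.comp k y z)
  exchange : ∀ {l k} (hlk : l < k) (hk : k ≤ n) x x₁ y y₁,
    X.Composable hk x x₁ → X.Composable hk y y₁ → X.Composable (hlk.le.trans hk) x y →
    X.comp l (X.comp k x x₁) (X.comp k y y₁) = X.comp k (X.comp l x y) (X.comp l x₁ y₁)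
  one_comp : ∀ {k} (hk : k ≤ n) x,
    X.comp k (X.one (B.oneIter hk (B.cIter hk (X.c x)))) x = x
  comp_one : ∀ {k} (hk : k ≤ n) x,
    X.comp k x (X.one (B.oneIter hk (B.dIter hk (X.d x)))) = x
  one_comp_one : ∀ {k} (hk : k < n) (a b : B.cell n), B.Composable hk.le a b →
    X.comp k (X.one a) (X.one b) = X.one (B.comp k a b)

end Layer

/-- The `(m+1)`-cells of `B`, as a layer over the cells of dimension `≤ m`. -/
def PreCat.layer (B : PreCat.{u}) (m : ℕ) : Layer B m where
  Top := B.cell (m + 1)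
  d := B.d
  c := B.c
  one := B.one
  comp := fun k => B.comp k

/-- A strict `ω`-category. -/
structure OmegaCat : Type (u + 1) extends PreCat.{u} where
  lawful : ∀ m, (toPreCat.layer m).Lawful

/-- An extension of the `n`-category `B_n`, the `n`-th truncation of `B`: an `(n+1)`-category whose
`n`-th truncation is `B_n`.  Such an `(n+1)`-category is given by its `(n+1)`-cells and the operations
on them.  (Every `n`-category is the `n`-th truncation of an `ω`-category; the cells of `B` of
dimension `> n` play no role.) -/
structure Extension (B : OmegaCat.{u}) (n : ℕ) : Type (u + 1)
    extends Layer B.toPreCat n where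
  lawful : toLayer.Lawful

/-- An `ω`-functor `X → Z` between two extensions of `B_n` that is the identity on the cells of
`B_n`: it is given by its action on the `(n+1)`-cells. -/
@[ext]
structure ExtHom {B : OmegaCat.{u}} {n : ℕ} (X Z : Extension B n) : Type u where
  toFun : X.Top → Z.Top
  map_d : ∀ x, Z.d (toFun x) = X.d x
  map_c : ∀ x, Z.c (toFun x) = X.c x
  map_one : ∀ a, toFun (X.one a) = Z.one a
  map_comp : ∀ {k} (hk : k ≤ n) x y, X.Composable hk x y →
    toFun (X.comp k x y) = Z.comp k (toFun x) (toFun y)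

/-- `F` is an isomorphism: it has an inverse `ω`-functor. -/
def ExtHom.IsIso {B : OmegaCat.{u}} {n : ℕ} {X Z : Extension B n} (F : ExtHom X Z) : Prop :=
  ∃ G : ExtHom Z X, (∀ x, G.toFun (F.toFun x) = x) ∧ (∀ z, F.toFun (G.toFun z) = z)

/-- `X` is freely generated, as an extension of `B_n`, by the set `J` of its `(n+1)`-cells. -/
def Extension.FreelyGeneratedBy {B : OmegaCat.{u}} {n : ℕ} (X : Extension B n)
    (J : Set X.Top) : Prop :=
  ∀ (Y : Extension B n) (φ : J → Y.Top),
    (∀ x : J, Y.d (φ x) = X.d x ∧ Y.c (φ x) = X.c x) →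
    ∃! F : ExtHom X Y, ∀ x : J, F.toFun x = φ x

/-- `B_{m+1}` as an extension of `B_m`. -/
def OmegaCat.extension (B : OmegaCat.{u}) (m : ℕ) : Extension B m where
  toLayer := B.toPreCat.layer m
  lawful := B.lawful m

/-- The `n`-category `B_n` is freely generated by the set `I` of `n`-cells: for `n > 0` it is a free
extension of `B_{n-1}` generated by `I`, and for `n = 0`, `I` consists of all `0`-cells. -/
def OmegaCat.FreelyGeneratedBy (B : OmegaCat.{u}) : ∀ n : ℕ, Set (B.cell n) → Prop
  | 0, I => I = Set.univ
  | m + 1, I => (B.extension m).FreelyGeneratedBy I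

/-! ### Terms and occurrences of indeterminates -/

/-- Terms built from the indets in `I`, the identity symbols and the composition symbols `•_k`,
`k < n`.  `CTerm B n I w` is the type of the terms that denote the `n`-cell `w`.  (As `d 1_a = a`, the
symbol `1_a` is determined by the cell that it denotes.) -/
inductive CTerm (B : OmegaCat.{u}) (n : ℕ) (I : Set (B.cell n)) : B.cell n → Type u
  | indet (x : B.cell n) (hx : x ∈ I) : CTerm B n I x
  | one (e : B.cell n) (he : B.IsOne e) : CTerm B n I e
  | comp {v w : B.cell n} (k : ℕ) (hk : k < n) (h : B.Composable hk.le v w)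
      (t : CTerm B n I v) (s : CTerm B n I w) : CTerm B n I (B.comp k v w)

namespace CTerm

variable {B : OmegaCat.{u}} {n : ℕ} {I : Set (B.cell n)}

/-- The places of a term at which an indet occurs. -/
def Occ : ∀ {w : B.cell n}, CTerm B n I w → Type
  | _, indet _ _ => Unit
  | _, one _ _ => Empty
  | _, comp _ _ _ t s => t.Occ ⊕ s.Occ

/-- The indet that occurs at a given place. -/
def label : ∀ {w : B.cell n} (t : CTerm B n I w), t.Occ → I
  | _, indet x hx => fun _ => ⟨x, hx⟩
  | _, one _ _ => fun r => r.elim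
  | _, comp _ _ _ t s => fun r =>
    match r with
    | Sum.inl r => t.label r
    | Sum.inr r => s.label r

/-- `Proves t s χ`: in the equational system of strict higher categories there is a proof of `t = s`
that induces the bijection `χ` between the indet occurrences in `t` and those in `s`. -/
inductive Proves : ∀ {v w : B.cell n} (t : CTerm B n I v) (s : CTerm B n I w),
    t.Occ ≃ s.Occ → Prop
  | refl {v} (t : CTerm B n I v) : Proves t t (Equiv.refl _)
  | symm {v w} {t : CTerm B n I v} {s : CTerm B n I w} {χ} :
      Proves t s χ → Proves s t χ.symm
  | trans {v w z} {t : CTerm B n I v} {s : CTerm B n I w} {p : CTerm B n I z} {χ ψ} :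
      Proves t s χ → Proves s p ψ → Proves t p (χ.trans ψ)
  | congr_left {v v' w} {k} (hk : k < n) (h : B.Composable hk.le v w)
      (h' : B.Composable hk.le v' w) {t : CTerm B n I v} {t' : CTerm B n I v'} {χ}
      (s : CTerm B n I w) :
      Proves t t' χ →
        Proves (comp k hk h t s) (comp k hk h' t' s) (Equiv.sumCongr χ (Equiv.refl s.Occ))
  | congr_right {v w w'} {k} (hk : k < n) (h : B.Composable hk.le v w)
      (h' : B.Composable hk.le v w') (t : CTerm B n I v) {s : CTerm B n I w}
      {s' : CTerm B n I w'} {χ} :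
      Proves s s' χ →
        Proves (comp k hk h t s) (comp k hk h' t s') (Equiv.sumCongr (Equiv.refl t.Occ) χ)
  | assoc {v w z} {k} (hk : k < n) (h₁ : B.Composable hk.le v w)
      (h₂ : B.Composable hk.le (B.comp k v w) z) (h₃ : B.Composable hk.le w z)
      (h₄ : B.Composable hk.le v (B.comp k w z))
      (t : CTerm B n I v) (s : CTerm B n I w) (p : CTerm B n I z) :
      Proves (comp k hk h₂ (comp k hk h₁ t s) p) (comp k hk h₄ t (comp k hk h₃ s p))
        (Equiv.sumAssoc t.Occ s.Occ p.Occ)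
  | exchange {v v₁ w w₁} {l k} (hl : l < n) (hk : k < n) (hlk : l < k)
      (h₁ : B.Composable hk.le v v₁) (h₂ : B.Composable hk.le w w₁)
      (h₃ : B.Composable hl.le (B.comp k v v₁) (B.comp k w w₁))
      (h₄ : B.Composable hl.le v w) (h₅ : B.Composable hl.le v₁ w₁)
      (h₆ : B.Composable hk.le (B.comp l v w) (B.comp l v₁ w₁))
      (t : CTerm B n I v) (t₁ : CTerm B n I v₁) (s : CTerm B n I w) (s₁ : CTerm B n I w₁) :
      Proves (comp l hl h₃ (comp k hk h₁ t t₁) (comp k hk h₂ s s₁))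
        (comp k hk h₆ (comp l hl h₄ t s) (comp l hl h₅ t₁ s₁))
        (Equiv.sumSumSumComm t.Occ t₁.Occ s.Occ s₁.Occ)
  | one_comp {e v} {k} (hk : k < n) (he : B.IsOne e)
      (_ : e = B.oneIter hk.le (B.cIter hk.le v)) (h : B.Composable hk.le e v)
      (t : CTerm B n I v) :
      Proves (comp k hk h (one e he) t) t (Equiv.emptySum Empty t.Occ)
  | comp_one {e v} {k} (hk : k < n) (he : B.IsOne e)
      (_ : e = B.oneIter hk.le (B.dIter hk.le v)) (h : B.Composable hk.le v e)
      (t : CTerm B n I v) :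
      Proves (comp k hk h t (one e he)) t (Equiv.sumEmpty t.Occ Empty)
  | one_comp_one {e f} {k} (hk : k < n) (he : B.IsOne e) (hf : B.IsOne f)
      (hef : B.IsOne (B.comp k e f)) (h : B.Composable hk.le e f) :
      Proves (comp k hk h (one e he) (one f hf)) (one (B.comp k e f) hef)
        (Equiv.sumEmpty Empty Empty)

/-- The result of replacing the `r`-occurrence of an indet `x` in `t` by an `n`-cell (meaningful for
`n`-cells parallel to `x`). -/
def replace : ∀ {w : B.cell n} (t : CTerm B n I w), t.Occ → B.cell n → B.cell n
  | _, indet _ _ => fun _ v => v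
  | _, one _ _ => fun r _ => r.elim
  | _, comp (v := w₁) (w := w₂) k _ _ t s => fun r v =>
    match r with
    | Sum.inl r => B.comp k (t.replace r v) w₂
    | Sum.inr r => B.comp k w₁ (s.replace r v)

/-- Generalized whiskering: the result of replacing the `r`-occurrence of an indet `x` in `t` by an
`(n+1)`-cell `v` (meaningful if the domain and codomain of `v` are parallel to `x`).  Here
`v •_k w = v •_k 1_w` for an `n`-cell `w`, and likewise on the other side. -/
def whisker (X : Extension B n) : ∀ {w : B.cell n} (t : CTerm B n I w), t.Occ → X.Top → X.Top
  | _, indet _ _ => fun _ v => v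
  | _, one _ _ => fun r _ => r.elim
  | _, comp (v := w₁) (w := w₂) k _ _ t s => fun r v =>
    match r with
    | Sum.inl r => X.comp k (t.whisker X r v) (X.one w₂)
    | Sum.inr r => X.comp k (X.one w₁) (s.whisker X r v)

end CTerm

/-! Facts needed to see that the operations below are well typed. -/

namespace OmegaCat

variable {B : OmegaCat.{u}} {n : ℕ}

theorem parallel_refl (x : B.cell n) : B.Parallel x x := by
  cases n with
  | zero => trivial
  | succ m => exact ⟨rfl, rfl⟩

theorem parallel_symm {x y : B.cell n} (h : B.Parallel x y) : B.Parallel y x := by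
  cases n with
  | zero => trivial
  | succ m => exact ⟨h.1.symm, h.2.symm⟩

theorem parallel_trans {x y z : B.cell n} (h : B.Parallel x y) (h' : B.Parallel y z) :
    B.Parallel x z := by
  cases n with
  | zero => trivial
  | succ m => exact ⟨h.1.trans h'.1, h.2.trans h'.2⟩

theorem dIter_self (x : B.cell n) : B.dIter le_rfl x = x :=
  Nat.decreasingInduction_self _ _

theorem cIter_self (x : B.cell n) : B.cIter le_rfl x = x :=
  Nat.decreasingInduction_self _ _

theorem dIter_succ {k m : ℕ} (hk : k ≤ m) (h : k ≤ m + 1) (x : B.cell (m + 1)) :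
    B.dIter h x = B.dIter hk (B.d x) :=
  Nat.decreasingInduction_succ _ _ _ _

theorem cIter_succ {k m : ℕ} (hk : k ≤ m) (h : k ≤ m + 1) (x : B.cell (m + 1)) :
    B.cIter h x = B.cIter hk (B.c x) :=
  Nat.decreasingInduction_succ _ _ _ _

theorem Parallel.dIter_eq {x y : B.cell n} (h : B.Parallel x y) {k : ℕ} (hk : k < n) :
    B.dIter hk.le x = B.dIter hk.le y := by
  cases n with
  | zero => exact absurd hk (Nat.not_lt_zero _)
  | succ m => rw [dIter_succ (Nat.lt_succ_iff.1 hk), dIter_succ (Nat.lt_succ_iff.1 hk), h.1]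

theorem Parallel.cIter_eq {x y : B.cell n} (h : B.Parallel x y) {k : ℕ} (hk : k < n) :
    B.cIter hk.le x = B.cIter hk.le y := by
  cases n with
  | zero => exact absurd hk (Nat.not_lt_zero _)
  | succ m => rw [cIter_succ (Nat.lt_succ_iff.1 hk), cIter_succ (Nat.lt_succ_iff.1 hk), h.2]

theorem composable_congr {x x' y y' : B.cell n} (hx : B.Parallel x x') (hy : B.Parallel y y')
    {k : ℕ} (hk : k < n) (h : B.Composable hk.le x y) : B.Composable hk.le x' y' :=
  ((Parallel.dIter_eq hx hk).symm.trans h).trans (Parallel.cIter_eq hy hk)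

theorem parallel_comp {x x' y y' : B.cell n} (hx : B.Parallel x x') (hy : B.Parallel y y')
    {k : ℕ} (hk : k < n) (h : B.Composable hk.le x y) :
    B.Parallel (B.comp k x y) (B.comp k x' y') := by
  have h' := composable_congr hx hy hk h
  cases n with
  | zero => trivial
  | succ m =>
    have hk' : k ≤ m := Nat.lt_succ_iff.1 hk
    have c1 : (B.layer m).Composable hk' x y := by
      have := h
      rw [PreCat.Composable, dIter_succ hk', cIter_succ hk'] at this
      exact this
    have c2 : (B.layer m).Composable hk' x' y' := by
      have := h'
      rw [PreCat.Composable, dIter_succ hk', cIter_succ hk'] at this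
      exact this
    rcases hk'.eq_or_lt with rfl | hlt
    · exact ⟨((B.lawful k).d_comp_top x y c1).trans
          (hy.1.trans ((B.lawful k).d_comp_top x' y' c2).symm),
        ((B.lawful k).c_comp_top x y c1).trans
          (hx.2.trans ((B.lawful k).c_comp_top x' y' c2).symm)⟩
    · refine ⟨((B.lawful m).d_comp hlt x y c1).trans (Eq.trans ?_
          ((B.lawful m).d_comp hlt x' y' c2).symm),
        ((B.lawful m).c_comp hlt x y c1).trans (Eq.trans ?_
          ((B.lawful m).c_comp hlt x' y' c2).symm)⟩
      · exact congrArg₂ (B.comp k) hx.1 hy.1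
      · exact congrArg₂ (B.comp k) hx.2 hy.2

end OmegaCat

namespace CTerm

variable {B : OmegaCat.{u}} {n : ℕ} {I : Set (B.cell n)}

theorem replace_parallel {w : B.cell n} (t : CTerm B n I w) (r : t.Occ) (v : B.cell n)
    (hv : B.Parallel v (t.label r)) : B.Parallel (t.replace r v) w := by
  induction t with
  | indet x hx => exact hv
  | one e he => exact nomatch r
  | comp k hk h t s iht ihs =>
    rcases r with r | r
    · have h1 := iht r hv
      exact OmegaCat.parallel_comp h1 (OmegaCat.parallel_refl _) hk
        (OmegaCat.composable_congr (OmegaCat.parallel_symm h1) (OmegaCat.parallel_refl _) hk h)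
    · have h1 := ihs r hv
      exact OmegaCat.parallel_comp (OmegaCat.parallel_refl _) h1 hk
        (OmegaCat.composable_congr (OmegaCat.parallel_refl _) (OmegaCat.parallel_symm h1) hk h)

/-- The domain and codomain of a generalized whiskering. -/
theorem whisker_dc (X : Extension B n) {w : B.cell n} (t : CTerm B n I w) (r : t.Occ) (v : X.Top)
    (hv : X.c v = t.label r) :
    X.d (t.whisker X r v) = t.replace r (X.d v) ∧ X.c (t.whisker X r v) = w := by
  induction t with
  | indet x hx => exact ⟨rfl, hv⟩
  | one e he => exact nomatch r
  | @comp w₁ w₂ k hk h t s iht ihs =>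
    have hp := X.lawful.parallel v
    rcases r with r | r
    · have h1 := iht r hv
      have h2 : B.Parallel (t.replace r (X.d v)) w₁ :=
        replace_parallel t r _ (by have := hp; rw [hv] at this; exact this)
      have hc : X.Composable hk.le (t.whisker X r v) (X.one w₂) := by
        unfold Layer.Composable
        rw [h1.1, X.lawful.c_one, OmegaCat.Parallel.dIter_eq h2 hk]
        exact h
      refine ⟨(X.lawful.d_comp hk _ _ hc).trans ?_, (X.lawful.c_comp hk _ _ hc).trans ?_⟩
      · rw [h1.1, X.lawful.d_one]; rfl
      · rw [h1.2, X.lawful.c_one]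
    · have h1 := ihs r hv
      have hc : X.Composable hk.le (X.one w₁) (s.whisker X r v) := by
        unfold Layer.Composable
        rw [h1.2, X.lawful.d_one]
        exact h
      refine ⟨(X.lawful.d_comp hk _ _ hc).trans ?_, (X.lawful.c_comp hk _ _ hc).trans ?_⟩
      · rw [h1.1, X.lawful.d_one]; rfl
      · rw [h1.2, X.lawful.c_one]

/-- The term `t[s/r]` obtained from `t` by putting the term `s` in the place `r`; it denotes the cell
obtained by the replacement of the `r`-occurrence in `t` by the cell that `s` denotes. -/
def subst : ∀ {w : B.cell n} (t : CTerm B n I w) (r : t.Occ) {v : B.cell n}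
    (_ : CTerm B n I v), B.Parallel v (t.label r) → CTerm B n I (t.replace r v)
  | _, indet _ _ => fun _ _ s _ => s
  | _, one _ _ => fun r _ _ _ => r.elim
  | _, comp k hk h t p => fun r v s =>
    match r with
    | Sum.inl r => fun hv =>
      comp k hk (OmegaCat.composable_congr
        (OmegaCat.parallel_symm (replace_parallel t r v hv)) (OmegaCat.parallel_refl _) hk h)
        (t.subst r s hv) p
    | Sum.inr r => fun hv =>
      comp k hk (OmegaCat.composable_congr
        (OmegaCat.parallel_refl _) (OmegaCat.parallel_symm (replace_parallel p r v hv)) hk h)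
        t (p.subst r s hv)

/-- The places of `t` other than `r`, seen as places of `t[s/r]`. -/
def substOld : ∀ {w : B.cell n} (t : CTerm B n I w) (r : t.Occ) {v : B.cell n}
    (s : CTerm B n I v) (hv : B.Parallel v (t.label r)) (q : t.Occ), q ≠ r → (t.subst r s hv).Occ
  | _, indet _ _ => fun _ _ _ _ _ hq => (hq rfl).elim
  | _, one _ _ => fun r _ _ _ _ _ => r.elim
  | _, comp _ _ _ t p => fun r _ s =>
    match r with
    | Sum.inl r => fun hv q =>
      match q with
      | Sum.inl q => fun hq => Sum.inl (t.substOld r s hv q (fun e => hq (congrArg Sum.inl e)))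
      | Sum.inr q => fun _ => Sum.inr q
    | Sum.inr r => fun hv q =>
      match q with
      | Sum.inl q => fun _ => Sum.inl q
      | Sum.inr q => fun hq => Sum.inr (p.substOld r s hv q (fun e => hq (congrArg Sum.inr e)))

/-- The places of `s`, seen as places of `t[s/r]`. -/
def substNew : ∀ {w : B.cell n} (t : CTerm B n I w) (r : t.Occ) {v : B.cell n}
    (s : CTerm B n I v) (hv : B.Parallel v (t.label r)), s.Occ → (t.subst r s hv).Occ
  | _, indet _ _ => fun _ _ _ _ q => q
  | _, one _ _ => fun r _ _ _ _ => r.elim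
  | _, comp _ _ _ t p => fun r _ s =>
    match r with
    | Sum.inl r => fun hv q => Sum.inl (t.substNew r s hv q)
    | Sum.inr r => fun hv q => Sum.inr (p.substNew r s hv q)

end CTerm

/-- The choices on which the notion of indet occurrence in an `n`-cell rests: for every `n`-cell `w` a
preferred specification, that is, a term `term w` denoting `w`, whose places index the indet
occurrences in `w`; and, for every replacement of the `r`-occurrence in `w` by a cell `v`, the
bijection `chi` induced by some proof of `t_w[t_v/r] = t`, with `t` the preferred term of the resulting
cell.  Through `chi` the occurrences in `w` other than `r` and the occurrences in `v` become occurrences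
in the resulting cell.  When `B_n` is freely generated by `I`, such choices exist, since every cell is
denoted by a term and the equational system is complete. -/
structure Occurrences (B : OmegaCat.{u}) (n : ℕ) (I : Set (B.cell n)) : Type u where
  term : ∀ w : B.cell n, CTerm B n I w
  chi : ∀ (w : B.cell n) (r : (term w).Occ) (v : B.cell n)
    (hv : B.Parallel v ((term w).label r)),
    ((term w).subst r (term v) hv).Occ ≃ (term ((term w).replace r v)).Occ
  chi_proves : ∀ w r v hv,
    CTerm.Proves ((term w).subst r (term v) hv) (term ((term w).replace r v)) (chi w r v hv)

namespace Occurrences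

variable {B : OmegaCat.{u}} {n : ℕ} {I : Set (B.cell n)} (O : Occurrences B n I)

/-- The index set `|w|` of the indet occurrences in the `n`-cell `w`. -/
def Idx (w : B.cell n) : Type := (O.term w).Occ

/-- The indexed set `⟨w⟩ : |w| → I` of indet occurrences in `w`. -/
def label {w : B.cell n} (r : O.Idx w) : I := (O.term w).label r

/-- Equal cells have the same occurrences. -/
def castIdx {v w : B.cell n} (h : v = w) : O.Idx v ≃ O.Idx w := Equiv.cast (congrArg O.Idx h)

end Occurrences

/-! ### Multicategories and their morphisms -/

/-- The constituents of a multicategory: objects, object types, arrows `a` with a source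
`src a : Idx a → Obj` and a target, the multicompositions `u ⊙_r v`, the coprojections `old`, `new`
that exhibit the source of `u ⊙_r v` as made of the places of `u` other than `r` and the places of `v`,
and the identity arrows.  The notion of morphism depends on nothing else. -/
structure MulticatData : Type (u + 1) where
  Obj : Type u
  ObjType : Type u
  typeOf : Obj → ObjType
  Arr : Type u
  Idx : Arr → Type
  src : ∀ a, Idx a → Obj
  tgt : Arr → ObjType
  comp : ∀ (a : Arr) (r : Idx a) (b : Arr), tgt b = typeOf (src a r) → Arr
  old : ∀ (a : Arr) (r : Idx a) (b : Arr) (h : tgt b = typeOf (src a r)) (q : Idx a), q ≠ r →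
    Idx (comp a r b h)
  new : ∀ (a : Arr) (r : Idx a) (b : Arr) (h : tgt b = typeOf (src a r)), Idx b →
    Idx (comp a r b h)
  ident : Obj → Arr

/-- A morphism of multicategories, with its bijections `θ_a : |S a| → |S (χ a)|`. -/
structure MulticatHom (C D : MulticatData.{u}) : Type u where
  obj : C.Obj → D.Obj
  objType : C.ObjType → D.ObjType
  typeOf_obj : ∀ x, D.typeOf (obj x) = objType (C.typeOf x)
  arr : C.Arr → D.Arr
  theta : ∀ a, C.Idx a ≃ D.Idx (arr a)
  tgt_arr : ∀ a, D.tgt (arr a) = objType (C.tgt a)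
  src_arr : ∀ a r, D.src (arr a) (theta a r) = obj (C.src a r)
  arr_ident : ∀ x, arr (C.ident x) = D.ident (obj x)
  arr_comp : ∀ (a : C.Arr) (r : C.Idx a) (b : C.Arr) (h : C.tgt b = C.typeOf (C.src a r)),
    arr (C.comp a r b h) =
      D.comp (arr a) (theta a r) (arr b) (by rw [tgt_arr, src_arr, typeOf_obj, h])
  theta_old : ∀ (a : C.Arr) (r : C.Idx a) (b : C.Arr) (h : C.tgt b = C.typeOf (C.src a r))
    (q : C.Idx a) (hq : q ≠ r),
    (⟨_, theta _ (C.old a r b h q hq)⟩ : Σ e, D.Idx e) =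
      ⟨_, D.old (arr a) (theta a r) (arr b) (by rw [tgt_arr, src_arr, typeOf_obj, h])
        (theta a q) ((theta a).injective.ne hq)⟩
  theta_new : ∀ (a : C.Arr) (r : C.Idx a) (b : C.Arr) (h : C.tgt b = C.typeOf (C.src a r))
    (q : C.Idx b),
    (⟨_, theta _ (C.new a r b h q)⟩ : Σ e, D.Idx e) =
      ⟨_, D.new (arr a) (theta a r) (arr b) (by rw [tgt_arr, src_arr, typeOf_obj, h])
        (theta b q)⟩

/-- `χ` is an isomorphism: it has an inverse morphism. -/
def MulticatHom.IsIso {C D : MulticatData.{u}} (χ : MulticatHom C D) : Prop :=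
  ∃ ψ : MulticatHom D C,
    (∀ x, ψ.obj (χ.obj x) = x) ∧ (∀ y, χ.obj (ψ.obj y) = y) ∧
    (∀ x, ψ.objType (χ.objType x) = x) ∧ (∀ y, χ.objType (ψ.objType y) = y) ∧
    (∀ a, ψ.arr (χ.arr a) = a) ∧ (∀ b, χ.arr (ψ.arr b) = b)

/-! ### Placed composition -/

namespace Extension

variable {B : OmegaCat.{u}} {n : ℕ}

/-- The many-to-one `(n+1)`-cells: those whose codomain is an indet. -/
def ManyToOne (X : Extension B n) (I : Set (B.cell n)) : Type u := {x : X.Top // X.c x ∈ I}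

variable {I : Set (B.cell n)} (O : Occurrences B n I) (X : Extension B n)

/-- The placed composition `a ∘_r b = a •_n (da □_r b)` of `(n+1)`-cells. -/
def placedComp (a : X.Top) (r : O.Idx (X.d a)) (b : X.Top) : X.Top :=
  X.comp n a ((O.term (X.d a)).whisker X r b)

theorem placedComp_dc (a : X.Top) (r : O.Idx (X.d a)) (b : X.Top) (h : X.c b = O.label r) :
    X.d (X.placedComp O a r b) = (O.term (X.d a)).replace r (X.d b) ∧
      X.c (X.placedComp O a r b) = X.c a := by
  have hw := CTerm.whisker_dc X (O.term (X.d a)) r b h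
  have hc : X.Composable le_rfl a ((O.term (X.d a)).whisker X r b) := by
    unfold Layer.Composable
    rw [hw.2, OmegaCat.dIter_self, OmegaCat.cIter_self]
  exact ⟨(X.lawful.d_comp_top _ _ hc).trans hw.1, X.lawful.c_comp_top _ _ hc⟩

theorem d_parallel_label (a : X.Top) (r : O.Idx (X.d a)) (b : X.Top) (h : X.c b = O.label r) :
    B.Parallel (X.d b) ((O.term (X.d a)).label r) := by
  have := X.lawful.parallel b
  rw [h] at this
  exact this

/-- The multicategory of placed composition of `X`.  The objects, which are also the object types, are
the indets in `I`, the arrows are the many-to-one `(n+1)`-cells `a`, with source `⟨da⟩` and target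
`ca`, multicomposition is placed composition, and the identity arrows are the identity cells. -/
def multicat : MulticatData.{u} where
  Obj := I
  ObjType := I
  typeOf := id
  Arr := X.ManyToOne I
  Idx := fun a => O.Idx (X.d a.1)
  src := fun _ r => O.label r
  tgt := fun a => ⟨X.c a.1, a.2⟩
  comp := fun a r b h =>
    ⟨X.placedComp O a.1 r b.1, by
      rw [(X.placedComp_dc O a.1 r b.1 (congrArg Subtype.val h)).2]; exact a.2⟩
  old := fun a r b h q hq =>
    O.castIdx (X.placedComp_dc O a.1 r b.1 (congrArg Subtype.val h)).1.symm
      (O.chi _ r _ (X.d_parallel_label O a.1 r b.1 (congrArg Subtype.val h))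
        ((O.term (X.d a.1)).substOld r (O.term (X.d b.1)) _ q hq))
  new := fun a r b h q =>
    O.castIdx (X.placedComp_dc O a.1 r b.1 (congrArg Subtype.val h)).1.symm
      (O.chi _ r _ (X.d_parallel_label O a.1 r b.1 (congrArg Subtype.val h))
        ((O.term (X.d a.1)).substNew r (O.term (X.d b.1)) _ q))
  ident := fun x => ⟨X.one x.1, by rw [X.lawful.c_one]; exact x.2⟩

end Extension

end Computad

namespace Computad

/-! Freeness of `X` turns the values of `χ` on `J` into a functor `F`, so the point is that `F` and
`χ` agree on every many-to-one cell. By the exchange law every `(n+1)`-cell of `X` is a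
`•_n`-composite of identities and of whiskered generators `w □_r f`. Composing with an identity
`1_x`, `x ∈ I`, on the left exhibits every many-to-one cell as an iterated placed composite of
generators with `1_x`: the multicategory of `X` is generated by `J`. A morphism out of it is
therefore determined by its values on `J`, and `χ` may be compared with the morphism that `F`
induces.

The whiskered generators arise from arbitrary terms, whereas placed composition refers to the
preferred ones. Whiskering is invariant under provable equality, and any two terms that denote the
same cell of a freely generated `B_n` are provably equal: terms up to provable equality form an
extension of `B_{n-1}`, and the functor from `B_n` that freeness provides sends each cell to the
class of every term denoting it. -/

/-! ### Composability -/

namespace OmegaCat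

variable {B : OmegaCat.{u}}

theorem composable_succ {m k : ℕ} (hk : k ≤ m) {x y : B.cell (m + 1)} :
    B.Composable (Nat.le_succ_of_le hk) x y ↔ (B.layer m).Composable hk x y := by
  rw [PreCat.Composable, dIter_succ hk, cIter_succ hk]
  rfl

theorem oneIter_self {n : ℕ} (a : B.cell n) : B.oneIter le_rfl a = a :=
  Nat.leRecOn_self a

theorem oneIter_succ {k m : ℕ} (hk : k ≤ m) (a : B.cell k) :
    B.oneIter (Nat.le_succ_of_le hk) a = B.one (B.oneIter hk a) :=
  Nat.leRecOn_succ hk a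

theorem dIter_oneIter {k n : ℕ} (hk : k ≤ n) (a : B.cell k) :
    B.dIter hk (B.oneIter hk a) = a := by
  induction n, hk using Nat.le_induction with
  | base => rw [dIter_self, oneIter_self]
  | succ m hm ih =>
    rw [oneIter_succ hm, dIter_succ hm]
    exact (congrArg (B.dIter hm) ((B.lawful m).d_one _)).trans ih

theorem cIter_oneIter {k n : ℕ} (hk : k ≤ n) (a : B.cell k) :
    B.cIter hk (B.oneIter hk a) = a := by
  induction n, hk using Nat.le_induction with
  | base => rw [cIter_self, oneIter_self]
  | succ m hm ih =>
    rw [oneIter_succ hm, cIter_succ hm]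
    exact (congrArg (B.cIter hm) ((B.lawful m).c_one _)).trans ih

end OmegaCat

namespace Layer

/-- The axioms of `Layer.Lawful` that concern the domain and codomain of a cell.  They suffice to
decide which composites are composable, and they pass to any layer that maps to a lawful one. -/
structure BoundaryLaws {B : PreCat.{u}} {n : ℕ} (X : Layer B n) : Prop where
  parallel : ∀ x, B.Parallel (X.d x) (X.c x)
  d_one : ∀ a, X.d (X.one a) = a
  c_one : ∀ a, X.c (X.one a) = a
  d_comp_top : ∀ x y, X.Composable le_rfl x y → X.d (X.comp n x y) = X.d y
  c_comp_top : ∀ x y, X.Composable le_rfl x y → X.c (X.comp n x y) = X.c x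
  d_comp : ∀ {k} (hk : k < n) x y, X.Composable hk.le x y →
    X.d (X.comp k x y) = B.comp k (X.d x) (X.d y)
  c_comp : ∀ {k} (hk : k < n) x y, X.Composable hk.le x y →
    X.c (X.comp k x y) = B.comp k (X.c x) (X.c y)

theorem Lawful.boundaryLaws {B : PreCat.{u}} {n : ℕ} {X : Layer B n} (hX : X.Lawful) :
    X.BoundaryLaws :=
  ⟨hX.parallel, hX.d_one, hX.c_one, hX.d_comp_top, hX.c_comp_top, hX.d_comp, hX.c_comp⟩

variable {B : OmegaCat.{u}} {n : ℕ} {X : Layer B.toPreCat n}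

theorem composable_top {x y : X.Top} : X.Composable le_rfl x y ↔ X.d x = X.c y := by
  rw [Layer.Composable, OmegaCat.dIter_self, OmegaCat.cIter_self]

namespace BoundaryLaws

theorem composable_iff_d (hX : X.BoundaryLaws) {k : ℕ} (hk : k < n) {x y : X.Top} :
    X.Composable hk.le x y ↔ B.Composable hk.le (X.d x) (X.d y) := by
  rw [Layer.Composable, PreCat.Composable, OmegaCat.Parallel.cIter_eq (hX.parallel y) hk]

theorem composable_iff_c (hX : X.BoundaryLaws) {k : ℕ} (hk : k < n) {x y : X.Top} :
    X.Composable hk.le x y ↔ B.Composable hk.le (X.c x) (X.c y) := by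
  rw [Layer.Composable, PreCat.Composable, OmegaCat.Parallel.dIter_eq (hX.parallel x) hk]

theorem layer_composable_d {m : ℕ} {X : Layer B.toPreCat (m + 1)} (hX : X.BoundaryLaws) {k : ℕ}
    (hk : k ≤ m) {x y : X.Top} (h : X.Composable (Nat.le_succ_of_le hk) x y) :
    (B.layer m).Composable hk (X.d x) (X.d y) :=
  (OmegaCat.composable_succ hk).1 ((hX.composable_iff_d (Nat.lt_succ_of_le hk)).1 h)

theorem layer_composable_c {m : ℕ} {X : Layer B.toPreCat (m + 1)} (hX : X.BoundaryLaws) {k : ℕ}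
    (hk : k ≤ m) {x y : X.Top} (h : X.Composable (Nat.le_succ_of_le hk) x y) :
    (B.layer m).Composable hk (X.c x) (X.c y) :=
  (OmegaCat.composable_succ hk).1 ((hX.composable_iff_c (Nat.lt_succ_of_le hk)).1 h)

theorem dIter_d_comp_of_le (hX : X.BoundaryLaws) {l k : ℕ} (hl : l ≤ k) (hk : k ≤ n)
    {x y : X.Top} (h : X.Composable hk x y) :
    B.dIter (hl.trans hk) (X.d (X.comp k x y)) = B.dIter (hl.trans hk) (X.d y) := by
  induction n with
  | zero =>
    obtain rfl := Nat.le_zero.1 hk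
    rw [hX.d_comp_top x y h]
  | succ m ih =>
    rcases hk.eq_or_lt with rfl | hlt
    · rw [hX.d_comp_top x y h]
    · have hk' := Nat.lt_succ_iff.1 hlt
      rw [hX.d_comp hlt x y h, OmegaCat.dIter_succ (hl.trans hk'),
        OmegaCat.dIter_succ (hl.trans hk')]
      exact ih (B.lawful m).boundaryLaws hk' (hX.layer_composable_d hk' h)

theorem cIter_c_comp_of_le (hX : X.BoundaryLaws) {l k : ℕ} (hl : l ≤ k) (hk : k ≤ n)
    {x y : X.Top} (h : X.Composable hk x y) :
    B.cIter (hl.trans hk) (X.c (X.comp k x y)) = B.cIter (hl.trans hk) (X.c x) := by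
  induction n with
  | zero =>
    obtain rfl := Nat.le_zero.1 hk
    rw [hX.c_comp_top x y h]
  | succ m ih =>
    rcases hk.eq_or_lt with rfl | hlt
    · rw [hX.c_comp_top x y h]
    · have hk' := Nat.lt_succ_iff.1 hlt
      rw [hX.c_comp hlt x y h, OmegaCat.cIter_succ (hl.trans hk'),
        OmegaCat.cIter_succ (hl.trans hk')]
      exact ih (B.lawful m).boundaryLaws hk' (hX.layer_composable_c hk' h)

theorem dIter_d_comp_of_lt (hX : X.BoundaryLaws) {l k : ℕ} (hl : l < k) (hk : k ≤ n)
    {x y : X.Top} (h : X.Composable (hl.le.trans hk) x y) :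
    B.dIter hk (X.d (X.comp l x y)) = B.comp l (B.dIter hk (X.d x)) (B.dIter hk (X.d y)) := by
  rw [hX.d_comp (hl.trans_le hk) x y h]
  induction n with
  | zero => exact absurd (hl.trans_le hk) (Nat.not_lt_zero _)
  | succ m ih =>
    rcases hk.eq_or_lt with rfl | hlt
    · simp only [OmegaCat.dIter_self]
    · have hk' := Nat.lt_succ_iff.1 hlt
      have hd := hX.layer_composable_d (hl.le.trans hk') h
      simp only [OmegaCat.dIter_succ hk']
      exact (congrArg (B.dIter hk') ((B.lawful m).d_comp (hl.trans_le hk') _ _ hd)).trans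
        (ih (B.lawful m).boundaryLaws hk' hd)

theorem cIter_c_comp_of_lt (hX : X.BoundaryLaws) {l k : ℕ} (hl : l < k) (hk : k ≤ n)
    {x y : X.Top} (h : X.Composable (hl.le.trans hk) x y) :
    B.cIter hk (X.c (X.comp l x y)) = B.comp l (B.cIter hk (X.c x)) (B.cIter hk (X.c y)) := by
  rw [hX.c_comp (hl.trans_le hk) x y h]
  induction n with
  | zero => exact absurd (hl.trans_le hk) (Nat.not_lt_zero _)
  | succ m ih =>
    rcases hk.eq_or_lt with rfl | hlt
    · simp only [OmegaCat.cIter_self]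
    · have hk' := Nat.lt_succ_iff.1 hlt
      have hc := hX.layer_composable_c (hl.le.trans hk') h
      simp only [OmegaCat.cIter_succ hk']
      exact (congrArg (B.cIter hk') ((B.lawful m).c_comp (hl.trans_le hk') _ _ hc)).trans
        (ih (B.lawful m).boundaryLaws hk' hc)

theorem dIter_d_eq (hX : X.BoundaryLaws) {l k : ℕ} (hl : l < k) (hk : k ≤ n) {x y : X.Top}
    (h : X.Composable hk x y) :
    B.dIter (hl.le.trans hk) (X.d x) = B.dIter (hl.le.trans hk) (X.d y) := by
  induction n with
  | zero => exact absurd (hl.trans_le hk) (Nat.not_lt_zero _)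
  | succ m ih =>
    rcases hk.eq_or_lt with rfl | hlt
    · rw [composable_top.1 h, OmegaCat.Parallel.dIter_eq (hX.parallel y) hl]
    · have hk' := Nat.lt_succ_iff.1 hlt
      simp only [OmegaCat.dIter_succ (hl.le.trans hk')]
      exact ih (B.lawful m).boundaryLaws hk' (hX.layer_composable_d hk' h)

theorem cIter_c_eq (hX : X.BoundaryLaws) {l k : ℕ} (hl : l < k) (hk : k ≤ n) {x y : X.Top}
    (h : X.Composable hk x y) :
    B.cIter (hl.le.trans hk) (X.c x) = B.cIter (hl.le.trans hk) (X.c y) := by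
  induction n with
  | zero => exact absurd (hl.trans_le hk) (Nat.not_lt_zero _)
  | succ m ih =>
    rcases hk.eq_or_lt with rfl | hlt
    · rw [← composable_top.1 h, OmegaCat.Parallel.cIter_eq (hX.parallel x) hl]
    · have hk' := Nat.lt_succ_iff.1 hlt
      simp only [OmegaCat.cIter_succ (hl.le.trans hk')]
      exact ih (B.lawful m).boundaryLaws hk' (hX.layer_composable_c hk' h)

section

variable {l k : ℕ} {x x₁ y y₁ z : X.Top}

theorem composable_comp_left (hX : X.BoundaryLaws) (hk : k ≤ n) (h : X.Composable hk x y)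
    (h' : X.Composable hk y z) : X.Composable hk (X.comp k x y) z :=
  (hX.dIter_d_comp_of_le le_rfl hk h).trans h'

theorem composable_comp_right (hX : X.BoundaryLaws) (hk : k ≤ n) (h : X.Composable hk x y)
    (h' : X.Composable hk y z) : X.Composable hk x (X.comp k y z) :=
  h.trans (hX.cIter_c_comp_of_le le_rfl hk h').symm

theorem composable_of_composable (hX : X.BoundaryLaws) (hl : l < k) (hk : k ≤ n)
    (h : X.Composable hk x x₁) (h' : X.Composable hk y y₁)
    (hxy : X.Composable (hl.le.trans hk) x y) : X.Composable (hl.le.trans hk) x₁ y₁ :=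
  ((hX.dIter_d_eq hl hk h).symm.trans hxy).trans (hX.cIter_c_eq hl hk h')

theorem composable_comp_comp_of_lt (hX : X.BoundaryLaws) (hl : l < k) (hk : k ≤ n)
    (h : X.Composable hk x x₁) (h' : X.Composable hk y y₁)
    (hxy : X.Composable (hl.le.trans hk) x y) :
    X.Composable (hl.le.trans hk) (X.comp k x x₁) (X.comp k y y₁) :=
  ((hX.dIter_d_comp_of_le hl.le hk h).trans (hX.dIter_d_eq hl hk h).symm).trans
    (hxy.trans (hX.cIter_c_comp_of_le hl.le hk h').symm)

theorem composable_comp_comp_of_gt (hX : X.BoundaryLaws) (hl : l < k) (hk : k ≤ n)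
    (h : X.Composable hk x x₁) (h' : X.Composable hk y y₁)
    (hxy : X.Composable (hl.le.trans hk) x y) :
    X.Composable hk (X.comp l x y) (X.comp l x₁ y₁) :=
  (hX.dIter_d_comp_of_lt hl hk hxy).trans ((congrArg₂ (B.comp l) h h').trans
    (hX.cIter_c_comp_of_lt hl hk (hX.composable_of_composable hl hk h h' hxy)).symm)

theorem one_oneIter_composable (hX : X.BoundaryLaws) (hk : k ≤ n) (x : X.Top) :
    X.Composable hk (X.one (B.oneIter hk (B.cIter hk (X.c x)))) x := by
  rw [Layer.Composable, hX.d_one, OmegaCat.dIter_oneIter]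

theorem composable_one_oneIter (hX : X.BoundaryLaws) (hk : k ≤ n) (x : X.Top) :
    X.Composable hk x (X.one (B.oneIter hk (B.dIter hk (X.d x)))) := by
  rw [Layer.Composable, hX.c_one, OmegaCat.cIter_oneIter]

theorem one_composable_self (hX : X.BoundaryLaws) (a : B.cell n) :
    X.Composable le_rfl (X.one a) (X.one a) :=
  composable_top.2 ((hX.d_one a).trans (hX.c_one a).symm)

theorem one_d_composable_iff (hX : X.BoundaryLaws) {hk : k ≤ n} :
    X.Composable hk (X.one (X.d x)) y ↔ X.Composable hk x y := by
  rw [Layer.Composable, Layer.Composable, hX.d_one]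

theorem composable_one_c_iff (hX : X.BoundaryLaws) {hk : k ≤ n} :
    X.Composable hk x (X.one (X.c y)) ↔ X.Composable hk x y := by
  rw [Layer.Composable, Layer.Composable, hX.c_one]

theorem one_composable_one_iff (hX : X.BoundaryLaws) {hk : k ≤ n} {a b : B.cell n} :
    X.Composable hk (X.one a) (X.one b) ↔ B.Composable hk a b := by
  rw [Layer.Composable, PreCat.Composable, hX.d_one, hX.c_one]

end

end BoundaryLaws

theorem Lawful.one_comp_top (hX : X.Lawful) (x : X.Top) : X.comp n (X.one (X.c x)) x = x := by
  simpa only [OmegaCat.cIter_self, OmegaCat.oneIter_self] using hX.one_comp le_rfl x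

theorem Lawful.comp_one_top (hX : X.Lawful) (x : X.Top) : X.comp n x (X.one (X.d x)) = x := by
  simpa only [OmegaCat.dIter_self, OmegaCat.oneIter_self] using hX.comp_one le_rfl x

theorem Lawful.one_comp_one_top (hX : X.Lawful) (a : B.cell n) :
    X.comp n (X.one a) (X.one a) = X.one a := by
  simpa only [hX.c_one] using hX.one_comp_top (X.one a)

end Layer

/-! ### Transfer of laws along maps of layers -/

namespace Layer

variable {B : OmegaCat.{u}} {n : ℕ} {X Y : Layer B.toPreCat n} {p : Y.Top → X.Top}

/-- The condition on `p` that defines an `ExtHom`, for layers that need not be lawful: it serves to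
prove that `Y` is lawful when `X` is. -/
structure IsHom {B : PreCat.{u}} {n : ℕ} (Y X : Layer B n) (p : Y.Top → X.Top) : Prop where
  map_d : ∀ y, X.d (p y) = Y.d y
  map_c : ∀ y, X.c (p y) = Y.c y
  map_one : ∀ a, p (Y.one a) = X.one a
  map_comp : ∀ {k} (hk : k ≤ n) x y, Y.Composable hk x y →
    p (Y.comp k x y) = X.comp k (p x) (p y)

namespace IsHom

theorem composable_iff (hp : IsHom Y X p) {k : ℕ} {hk : k ≤ n} {x y : Y.Top} :
    X.Composable hk (p x) (p y) ↔ Y.Composable hk x y := by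
  rw [Layer.Composable, Layer.Composable, hp.map_d, hp.map_c]

theorem boundaryLaws (hp : IsHom Y X p) (hX : X.BoundaryLaws) : Y.BoundaryLaws where
  parallel x := by
    rw [← hp.map_d, ← hp.map_c]
    exact hX.parallel (p x)
  d_one a := by rw [← hp.map_d, hp.map_one, hX.d_one]
  c_one a := by rw [← hp.map_c, hp.map_one, hX.c_one]
  d_comp_top x y h := by
    rw [← hp.map_d, hp.map_comp le_rfl x y h, hX.d_comp_top _ _ (hp.composable_iff.2 h), hp.map_d]
  c_comp_top x y h := by
    rw [← hp.map_c, hp.map_comp le_rfl x y h, hX.c_comp_top _ _ (hp.composable_iff.2 h), hp.map_c]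
  d_comp hk x y h := by
    rw [← hp.map_d, hp.map_comp hk.le x y h, hX.d_comp hk _ _ (hp.composable_iff.2 h), hp.map_d,
      hp.map_d]
  c_comp hk x y h := by
    rw [← hp.map_c, hp.map_comp hk.le x y h, hX.c_comp hk _ _ (hp.composable_iff.2 h), hp.map_c,
      hp.map_c]

theorem lawful_of_injective (hp : IsHom Y X p) (hX : X.Lawful) (hinj : Function.Injective p) :
    Y.Lawful :=
  have hY : Y.BoundaryLaws := hp.boundaryLaws hX.boundaryLaws
  { hY with
    assoc := fun hk x y z h h' => hinj <| by
      rw [hp.map_comp hk _ _ (hY.composable_comp_left hk h h'), hp.map_comp hk _ _ h,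
        hp.map_comp hk _ _ (hY.composable_comp_right hk h h'), hp.map_comp hk _ _ h',
        hX.assoc hk _ _ _ (hp.composable_iff.2 h) (hp.composable_iff.2 h')]
    exchange := fun hl hk x x₁ y y₁ h h' hxy => hinj <| by
      rw [hp.map_comp (hl.le.trans hk) _ _ (hY.composable_comp_comp_of_lt hl hk h h' hxy),
        hp.map_comp hk _ _ h, hp.map_comp hk _ _ h',
        hp.map_comp hk _ _ (hY.composable_comp_comp_of_gt hl hk h h' hxy),
        hp.map_comp (hl.le.trans hk) _ _ hxy,
        hp.map_comp (hl.le.trans hk) _ _ (hY.composable_of_composable hl hk h h' hxy),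
        hX.exchange hl hk _ _ _ _ (hp.composable_iff.2 h) (hp.composable_iff.2 h')
          (hp.composable_iff.2 hxy)]
    one_comp := fun hk x => hinj <| by
      rw [hp.map_comp hk _ _ (hY.one_oneIter_composable hk x), hp.map_one, ← hp.map_c,
        hX.one_comp hk]
    comp_one := fun hk x => hinj <| by
      rw [hp.map_comp hk _ _ (hY.composable_one_oneIter hk x), hp.map_one, ← hp.map_d,
        hX.comp_one hk]
    one_comp_one := fun hk a b h => hinj <| by
      rw [hp.map_comp hk.le _ _ (hY.one_composable_one_iff.2 h), hp.map_one, hp.map_one, hp.map_one,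
        hX.one_comp_one hk a b h] }

end IsHom

end Layer

/-! ### Soundness of the equational system -/

namespace CTerm

variable {B : OmegaCat.{u}} {n : ℕ} {I : Set (B.cell n)}

/-- The `(n+1)`-cell of an extension obtained from a term by putting the `(n+1)`-cell `ρ q` in each
place `q`, a symbol `1_b` being read as `1_{1_b}` (meaningful if `c (ρ q)` is the indet at the place
`q`).  Whiskering is the case in which all `ρ q` but one are identities. -/
def eval (X : Extension B n) : ∀ {w : B.cell n} (t : CTerm B n I w), (t.Occ → X.Top) → X.Top
  | _, indet _ _ => fun ρ => ρ ()
  | _, one e _ => fun _ => X.one e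
  | _, comp k _ _ t s => fun ρ =>
    X.comp k (t.eval X fun q => ρ (Sum.inl q)) (s.eval X fun q => ρ (Sum.inr q))

variable (X : Extension B n)

theorem c_eval {w : B.cell n} (t : CTerm B n I w) {ρ : t.Occ → X.Top}
    (hρ : ∀ q, X.c (ρ q) = t.label q) : X.c (t.eval X ρ) = w := by
  induction t with
  | indet x hx => exact hρ ()
  | one e he => exact X.lawful.c_one e
  | comp k hk h t s iht ihs =>
    have ht := iht fun q => hρ (Sum.inl q)
    have hs := ihs fun q => hρ (Sum.inr q)
    refine (X.lawful.c_comp hk _ _ ?_).trans (congrArg₂ (B.comp k) ht hs)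
    rw [X.lawful.boundaryLaws.composable_iff_c hk, ht, hs]
    exact h

theorem eval_composable {v w : B.cell n} (t : CTerm B n I v) (s : CTerm B n I w) {k : ℕ}
    (hk : k < n) (h : B.Composable hk.le v w) {ρ : t.Occ → X.Top} {σ : s.Occ → X.Top}
    (hρ : ∀ q, X.c (ρ q) = t.label q) (hσ : ∀ q, X.c (σ q) = s.label q) :
    X.Composable hk.le (t.eval X ρ) (s.eval X σ) := by
  rw [X.lawful.boundaryLaws.composable_iff_c hk, c_eval X t hρ, c_eval X s hσ]
  exact h

theorem eval_eq_one {w : B.cell n} (t : CTerm B n I w) {ρ : t.Occ → X.Top}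
    (hρ : ∀ q, ρ q = X.one (t.label q)) : t.eval X ρ = X.one w := by
  induction t with
  | indet x hx => exact hρ ()
  | one e he => rfl
  | comp k hk h t s iht ihs =>
    exact (congrArg₂ (X.comp k) (iht fun q => hρ (.inl q)) (ihs fun q => hρ (.inr q))).trans
      (X.lawful.one_comp_one hk _ _ h)

theorem eval_eq_whisker {w : B.cell n} (t : CTerm B n I w) {ρ : t.Occ → X.Top} {r : t.Occ}
    (hρ : ∀ q ≠ r, ρ q = X.one (t.label q)) : t.eval X ρ = t.whisker X r (ρ r) := by
  induction t with
  | indet x hx => rfl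
  | one e he => exact nomatch r
  | comp k hk h t s iht ihs =>
    rcases r with r | r
    · exact congrArg₂ (X.comp k) (iht fun q hq => hρ _ (Sum.inl_injective.ne hq))
        (eval_eq_one X s fun q => hρ _ Sum.inr_ne_inl)
    · exact congrArg₂ (X.comp k) (eval_eq_one X t fun q => hρ _ Sum.inl_ne_inr)
        (ihs fun q hq => hρ _ (Sum.inr_injective.ne hq))

namespace Proves

theorem label_eq {v w : B.cell n} {t : CTerm B n I v} {s : CTerm B n I w} {χ : t.Occ ≃ s.Occ}
    (h : Proves t s χ) (q : t.Occ) : s.label (χ q) = t.label q := by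
  induction h with
  | refl t => rfl
  | symm _ ih => rw [← ih, Equiv.apply_symm_apply]
  | trans _ _ ih ih' => exact (ih' _).trans (ih q)
  | congr_left _ _ _ s _ ih => exact Sum.casesOn q ih fun _ => rfl
  | congr_right _ _ _ t _ ih => exact Sum.casesOn q (fun _ => rfl) ih
  | assoc => rcases q with (_ | _) | _ <;> rfl
  | exchange => rcases q with (_ | _) | (_ | _) <;> rfl
  | one_comp => exact Sum.casesOn q Empty.rec fun _ => rfl
  | comp_one => exact Sum.casesOn q (fun _ => rfl) Empty.rec
  | one_comp_one => exact Sum.casesOn q Empty.rec Empty.rec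

theorem eval_eq {v w : B.cell n} {t : CTerm B n I v} {s : CTerm B n I w} {χ : t.Occ ≃ s.Occ}
    (h : Proves t s χ) {ρ : s.Occ → X.Top} (hρ : ∀ q, X.c (ρ q) = s.label q) :
    (t.eval X fun q => ρ (χ q)) = s.eval X ρ := by
  induction h with
  | refl t => rfl
  | @symm _ _ t s χ h ih =>
    have := ih (ρ := fun q => ρ (χ.symm q)) fun q => by
      rw [hρ, ← h.label_eq, Equiv.apply_symm_apply]
    simpa only [Equiv.symm_apply_apply] using this.symm
  | @trans _ _ _ _ _ _ _ _ _ h' ih ih' =>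
    rw [← ih' hρ]
    exact ih fun q => (hρ _).trans (congrArg Subtype.val (h'.label_eq q))
  | congr_left _ _ _ s _ ih =>
    exact congrArg (X.comp _ · _) (ih fun q => hρ (Sum.inl q))
  | congr_right _ _ _ t _ ih =>
    exact congrArg (X.comp _ _) (ih fun q => hρ (Sum.inr q))
  | assoc hk h₁ h₂ h₃ h₄ t s p =>
    exact X.lawful.assoc hk.le _ _ _
      (eval_composable X t s hk h₁ (fun q => hρ (.inl q)) fun q => hρ (.inr (.inl q)))
      (eval_composable X s p hk h₃ (fun q => hρ (.inr (.inl q))) fun q => hρ (.inr (.inr q)))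
  | exchange hl hk hlk h₁ h₂ h₃ h₄ h₅ h₆ t t₁ s s₁ =>
    exact X.lawful.exchange hlk hk.le _ _ _ _
      (eval_composable X t t₁ hk h₁ (fun q => hρ (.inl (.inl q))) fun q => hρ (.inr (.inl q)))
      (eval_composable X s s₁ hk h₂ (fun q => hρ (.inl (.inr q))) fun q => hρ (.inr (.inr q)))
      (eval_composable X t s hl h₄ (fun q => hρ (.inl (.inl q))) fun q => hρ (.inl (.inr q)))
  | one_comp hk _ e_eq _ t =>
    have := X.lawful.one_comp hk.le (t.eval X ρ)
    rw [c_eval X t hρ, ← e_eq] at this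
    exact this
  | comp_one hk _ e_eq _ t =>
    have := X.lawful.comp_one hk.le (t.eval X ρ)
    rw [OmegaCat.Parallel.dIter_eq (X.lawful.parallel _) hk, c_eval X t hρ, ← e_eq] at this
    exact this
  | one_comp_one hk _ _ _ h => exact X.lawful.one_comp_one hk _ _ h

theorem cell_eq {v w : B.cell n} {t : CTerm B n I v} {s : CTerm B n I w} {χ : t.Occ ≃ s.Occ}
    (h : Proves t s χ) : v = w := by
  let Y := B.extension n
  have hone : Y.one v = Y.one w := calc
    Y.one v = t.eval Y fun q => Y.one (s.label (χ q)) :=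
      (eval_eq_one Y t fun q => by rw [h.label_eq]).symm
    _ = s.eval Y fun q => Y.one (s.label q) := h.eval_eq Y fun q => Y.lawful.c_one _
    _ = Y.one w := eval_eq_one Y s fun _ => rfl
  rw [← Y.lawful.d_one v, hone, Y.lawful.d_one]

open Classical in
theorem whisker_eq {v w : B.cell n} {t : CTerm B n I v} {s : CTerm B n I w} {χ : t.Occ ≃ s.Occ}
    (h : Proves t s χ) (r : t.Occ) {a : X.Top} (ha : X.c a = t.label r) :
    t.whisker X r a = s.whisker X (χ r) a := by
  let ρ := Function.update (fun q => X.one (s.label q)) (χ r) a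
  have hr : ρ (χ r) = a := Function.update_self ..
  have hne (q) (hq : q ≠ χ r) : ρ q = X.one (s.label q) := Function.update_of_ne hq ..
  have hρ (q) : X.c (ρ q) = s.label q := by
    obtain rfl | hq := eq_or_ne q (χ r)
    · rw [hr, h.label_eq, ha]
    · rw [hne q hq, X.lawful.c_one]
  calc t.whisker X r a = t.whisker X r (ρ (χ r)) := by rw [hr]
    _ = t.eval X fun q => ρ (χ q) := (eval_eq_whisker X t (ρ := fun q => ρ (χ q)) fun q hq => by
        rw [hne _ (χ.injective.ne hq), h.label_eq]).symm
    _ = s.eval X ρ := h.eval_eq X hρ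
    _ = s.whisker X (χ r) (ρ (χ r)) := eval_eq_whisker X s hne
    _ = s.whisker X (χ r) a := by rw [hr]

end Proves

end CTerm

/-! ### Completeness of the equational system -/

namespace CTerm

variable {B : OmegaCat.{u}} {n : ℕ} {I : Set (B.cell n)}

/-- Provable equality of terms, as a setoid on terms paired with the cells that they denote. -/
def provableSetoid (I : Set (B.cell n)) : Setoid (Σ w, CTerm B n I w) where
  r a b := ∃ χ, Proves a.2 b.2 χ
  iseqv :=
    { refl := fun a => ⟨_, .refl a.2⟩
      symm := fun ⟨_, h⟩ => ⟨_, h.symm⟩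
      trans := fun ⟨_, h⟩ ⟨_, h'⟩ => ⟨_, h.trans h'⟩ }

/-- Terms up to provable equality: the cells of the extension that witnesses completeness. -/
def TermClass (I : Set (B.cell n)) : Type u :=
  Quotient (provableSetoid I)

namespace TermClass

/-- The class of a term. -/
def mk {w : B.cell n} (t : CTerm B n I w) : TermClass I :=
  Quotient.mk (provableSetoid I) ⟨w, t⟩

theorem mk_eq_mk {v w : B.cell n} {t : CTerm B n I v} {s : CTerm B n I w} :
    mk t = mk s ↔ ∃ χ, Proves t s χ :=
  Quotient.eq (r := provableSetoid I)

theorem ind {p : TermClass I → Prop} (h : ∀ w (t : CTerm B n I w), p (mk t)) (x : TermClass I) :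
    p x :=
  Quotient.inductionOn x fun a => h a.1 a.2

theorem mk_one_congr {e f : B.cell n} (h : e = f) (he : B.IsOne e) (hf : B.IsOne f) :
    mk (one e he : CTerm B n I e) = mk (one f hf) := by
  subst h
  rfl

/-- The cell denoted by the terms of a class. -/
def cell (x : TermClass I) : B.cell n :=
  Quotient.lift (s := provableSetoid I) Sigma.fst (fun _ _ ⟨_, h⟩ => h.cell_eq) x

open Classical in
/-- Composition of classes of terms; on classes that are not composable it returns the first one. -/
noncomputable def comp (k : ℕ) (x y : TermClass I) : TermClass I :=
  Quotient.liftOn₂ (s₁ := provableSetoid I) (s₂ := provableSetoid I) x y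
    (fun a b => if h : ∃ hk : k < n, B.Composable hk.le a.1 b.1 then
      mk (CTerm.comp k h.1 h.2 a.2 b.2) else mk a.2)
    (by
      rintro ⟨v, t⟩ ⟨w, s⟩ ⟨v', t'⟩ ⟨w', s'⟩ ⟨χ, h⟩ ⟨ψ, h'⟩
      dsimp only at h h' ⊢
      cases h.cell_eq
      cases h'.cell_eq
      split_ifs with hc
      · exact mk_eq_mk.2 ⟨_, (Proves.congr_left hc.1 hc.2 hc.2 s h).trans
          (Proves.congr_right hc.1 hc.2 hc.2 t' h')⟩
      · exact mk_eq_mk.2 ⟨_, h⟩)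

theorem comp_mk_mk {k : ℕ} (hk : k < n) {v w : B.cell n} (h : B.Composable hk.le v w)
    (t : CTerm B n I v) (s : CTerm B n I w) : comp k (mk t) (mk s) = mk (t.comp k hk h s) :=
  dif_pos (⟨hk, h⟩ : ∃ hk : k < n, B.Composable hk.le v w)

end TermClass

section TermLayer

variable {m k : ℕ} {I : Set (B.cell (m + 1))}

/-- The terms for `(m+1)`-cells up to provable equality, as a layer over the cells of dimension
`≤ m`. -/
noncomputable def termLayer (I : Set (B.cell (m + 1))) : Layer B.toPreCat m where
  Top := TermClass I
  d x := B.d x.cell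
  c x := B.c x.cell
  one a := TermClass.mk (one (B.one a) ⟨a, rfl⟩)
  comp := TermClass.comp

theorem termLayer_comp_mk (hk : k ≤ m) {v w : B.cell (m + 1)}
    (h : (B.layer m).Composable hk v w) (t : CTerm B (m + 1) I v) (s : CTerm B (m + 1) I w) :
    (termLayer I).comp k (.mk t) (.mk s) =
      .mk (t.comp k (Nat.lt_succ_of_le hk) ((OmegaCat.composable_succ hk).2 h) s) :=
  TermClass.comp_mk_mk _ _ t s

theorem isHom_cell (I : Set (B.cell (m + 1))) :
    Layer.IsHom (termLayer I) (B.layer m) TermClass.cell where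
  map_d _ := rfl
  map_c _ := rfl
  map_one _ := rfl
  map_comp hk x y h := by
    induction x using TermClass.ind with | _ v t
    induction y using TermClass.ind with | _ w s
    exact congrArg TermClass.cell (termLayer_comp_mk hk h t s)

theorem termLayer_assoc (hk : k ≤ m) {u v w : B.cell (m + 1)} (t : CTerm B (m + 1) I u)
    (s : CTerm B (m + 1) I v) (p : CTerm B (m + 1) I w)
    (h : (B.layer m).Composable hk u v) (h' : (B.layer m).Composable hk v w) :
    (termLayer I).comp k ((termLayer I).comp k (.mk t) (.mk s)) (.mk p) =
      (termLayer I).comp k (.mk t) ((termLayer I).comp k (.mk s) (.mk p)) := by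
  have h₁ : (B.layer m).Composable hk (B.comp k u v) w :=
    (B.lawful m).boundaryLaws.composable_comp_left hk h h'
  have h₂ : (B.layer m).Composable hk u (B.comp k v w) :=
    (B.lawful m).boundaryLaws.composable_comp_right hk h h'
  rw [termLayer_comp_mk hk h, termLayer_comp_mk hk h', termLayer_comp_mk hk h₁,
    termLayer_comp_mk hk h₂]
  exact TermClass.mk_eq_mk.2 ⟨_, .assoc ..⟩

theorem termLayer_exchange {l : ℕ} (hl : l < k) (hk : k ≤ m) {v v₁ w w₁ : B.cell (m + 1)}
    (t : CTerm B (m + 1) I v) (t₁ : CTerm B (m + 1) I v₁) (s : CTerm B (m + 1) I w)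
    (s₁ : CTerm B (m + 1) I w₁) (h : (B.layer m).Composable hk v v₁)
    (h' : (B.layer m).Composable hk w w₁)
    (hvw : (B.layer m).Composable (hl.le.trans hk) v w) :
    (termLayer I).comp l ((termLayer I).comp k (.mk t) (.mk t₁))
        ((termLayer I).comp k (.mk s) (.mk s₁)) =
      (termLayer I).comp k ((termLayer I).comp l (.mk t) (.mk s))
        ((termLayer I).comp l (.mk t₁) (.mk s₁)) := by
  have hB := (B.lawful m).boundaryLaws
  have h₁ : (B.layer m).Composable _ v₁ w₁ := hB.composable_of_composable hl hk h h' hvw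
  have h₂ : (B.layer m).Composable _ (B.comp k v v₁) (B.comp k w w₁) :=
    hB.composable_comp_comp_of_lt hl hk h h' hvw
  have h₃ : (B.layer m).Composable _ (B.comp l v w) (B.comp l v₁ w₁) :=
    hB.composable_comp_comp_of_gt hl hk h h' hvw
  rw [termLayer_comp_mk hk h, termLayer_comp_mk hk h', termLayer_comp_mk _ hvw,
    termLayer_comp_mk _ h₁, termLayer_comp_mk _ h₂, termLayer_comp_mk hk h₃]
  exact TermClass.mk_eq_mk.2 ⟨_, .exchange _ _ hl _ _ _ _ _ _ t t₁ s s₁⟩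

theorem termLayer_one_comp (hk : k ≤ m) {v : B.cell (m + 1)} (t : CTerm B (m + 1) I v) :
    (termLayer I).comp k ((termLayer I).one (B.oneIter hk (B.cIter hk (B.c v)))) (.mk t) =
      .mk t := by
  refine (termLayer_comp_mk hk ((B.lawful m).boundaryLaws.one_oneIter_composable hk v) _ t).trans
    (TermClass.mk_eq_mk.2 ⟨_, .one_comp _ _ ?_ _ t⟩)
  rw [OmegaCat.cIter_succ hk, OmegaCat.oneIter_succ hk]
  rfl

theorem termLayer_comp_one (hk : k ≤ m) {v : B.cell (m + 1)} (t : CTerm B (m + 1) I v) :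
    (termLayer I).comp k (.mk t) ((termLayer I).one (B.oneIter hk (B.dIter hk (B.d v)))) =
      .mk t := by
  refine (termLayer_comp_mk hk ((B.lawful m).boundaryLaws.composable_one_oneIter hk v) t _).trans
    (TermClass.mk_eq_mk.2 ⟨_, .comp_one _ _ ?_ _ t⟩)
  rw [OmegaCat.dIter_succ hk, OmegaCat.oneIter_succ hk]
  rfl

theorem termLayer_one_comp_one (hk : k < m) {a b : B.cell m} (h : B.Composable hk.le a b) :
    (termLayer I).comp k ((termLayer I).one a) ((termLayer I).one b) =
      (termLayer I).one (B.comp k a b) := by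
  have hone : B.comp k (B.one a) (B.one b) = B.one (B.comp k a b) :=
    (B.lawful m).one_comp_one hk a b h
  have hab : (B.layer m).Composable hk.le (B.one a) (B.one b) :=
    (B.lawful m).boundaryLaws.one_composable_one_iff.2 h
  have hprov : ∃ χ, Proves (I := I) (comp k (Nat.lt_succ_of_le hk.le)
      ((OmegaCat.composable_succ hk.le).2 hab) (one (B.one a) ⟨a, rfl⟩) (one (B.one b) ⟨b, rfl⟩))
      (one (B.comp k (B.one a) (B.one b)) ⟨_, hone.symm⟩) χ := ⟨_, .one_comp_one ..⟩
  exact (termLayer_comp_mk hk.le hab _ _).trans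
    ((TermClass.mk_eq_mk.2 hprov).trans (TermClass.mk_one_congr hone _ _))

theorem termLayer_lawful (I : Set (B.cell (m + 1))) : (termLayer I).Lawful where
  __ := (isHom_cell I).boundaryLaws (B.lawful m).boundaryLaws
  assoc hk x y z h h' := by
    induction x using TermClass.ind with | _ u t
    induction y using TermClass.ind with | _ v s
    induction z using TermClass.ind with | _ w p
    exact termLayer_assoc hk t s p h h'
  exchange hl hk x x₁ y y₁ h h' hxy := by
    induction x using TermClass.ind with | _ v t
    induction x₁ using TermClass.ind with | _ v₁ t₁
    induction y using TermClass.ind with | _ w s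
    induction y₁ using TermClass.ind with | _ w₁ s₁
    exact termLayer_exchange hl hk t t₁ s s₁ h h' hxy
  one_comp hk x := by
    induction x using TermClass.ind with | _ v t
    exact termLayer_one_comp hk t
  comp_one hk x := by
    induction x using TermClass.ind with | _ v t
    exact termLayer_comp_one hk t
  one_comp_one hk _ _ h := termLayer_one_comp_one hk h

/-- The extension of `B_m` whose `(m+1)`-cells are the terms up to provable equality. -/
noncomputable def termExtension (I : Set (B.cell (m + 1))) : Extension B m where
  toLayer := termLayer I
  lawful := termLayer_lawful I

theorem toFun_eq_mk (E : ExtHom (B.extension m) (termExtension I))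
    (hE : ∀ x (hx : x ∈ I), E.toFun x = .mk (indet x hx)) {w : B.cell (m + 1)}
    (t : CTerm B (m + 1) I w) : E.toFun w = .mk t := by
  induction t with
  | indet x hx => exact hE x hx
  | one e he =>
    obtain ⟨a, rfl⟩ := he
    exact E.map_one a
  | comp k hk h t s iht ihs =>
    refine (E.map_comp (Nat.lt_succ_iff.1 hk) _ _ ((OmegaCat.composable_succ _).1 h)).trans ?_
    rw [iht, ihs]
    exact TermClass.comp_mk_mk hk h t s

end TermLayer

theorem exists_proves (hI : B.FreelyGeneratedBy n I) {w : B.cell n} (t s : CTerm B n I w) :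
    ∃ χ, Proves t s χ := by
  cases n with
  | zero =>
    cases t with
    | indet =>
      cases s with
      | indet => exact ⟨_, .refl _⟩
      | one _ he => exact he.elim
      | comp k hk => exact absurd hk (Nat.not_lt_zero _)
    | one _ he => exact he.elim
    | comp k hk => exact absurd hk (Nat.not_lt_zero _)
  | succ m =>
    obtain ⟨E, hE, -⟩ := hI (termExtension I) (fun x => .mk (indet x.1 x.2)) fun _ => ⟨rfl, rfl⟩
    have hE' (x) (hx : x ∈ I) : E.toFun x = .mk (indet x hx) := hE ⟨x, hx⟩
    exact TermClass.mk_eq_mk.1 ((toFun_eq_mk E hE' t).symm.trans (toFun_eq_mk E hE' s))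

end CTerm

/-! ### Cells of a freely generated extension -/

namespace ExtHom

variable {B : OmegaCat.{u}} {n : ℕ} {X Y Z : Extension B n}

theorem isHom (F : ExtHom X Y) : Layer.IsHom X.toLayer Y.toLayer F.toFun :=
  ⟨F.map_d, F.map_c, F.map_one, F.map_comp⟩

/-- The identity functor. -/
def id (X : Extension B n) : ExtHom X X :=
  ⟨fun x => x, fun _ => rfl, fun _ => rfl, fun _ => rfl, fun _ _ _ _ => rfl⟩

/-- The composite of two functors, in diagrammatic order. -/
def trans (F : ExtHom X Y) (G : ExtHom Y Z) : ExtHom X Z where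
  toFun x := G.toFun (F.toFun x)
  map_d x := (G.map_d _).trans (F.map_d x)
  map_c x := (G.map_c _).trans (F.map_c x)
  map_one a := (congrArg _ (F.map_one a)).trans (G.map_one a)
  map_comp hk x y h :=
    (congrArg _ (F.map_comp hk x y h)).trans (G.map_comp hk _ _ (F.isHom.composable_iff.2 h))

end ExtHom

namespace Extension

variable {B : OmegaCat.{u}} {n : ℕ} {X Y : Extension B n} {J : Set X.Top}

theorem FreelyGeneratedBy.hom_ext (hJ : X.FreelyGeneratedBy J) {F G : ExtHom X Y}
    (h : ∀ x ∈ J, F.toFun x = G.toFun x) : F = G := by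
  obtain ⟨H, -, hH⟩ := hJ Y (fun x => F.toFun x) (fun x => ⟨F.map_d x, F.map_c x⟩)
  exact (hH F fun _ => rfl).trans (hH G fun x => (h x x.2).symm).symm

section Sub

variable (X) (P : X.Top → Prop) (hone : ∀ a, P (X.one a))
  (hcomp : ∀ {k} (hk : k ≤ n) x y, X.Composable hk x y → P x → P y → P (X.comp k x y))

open Classical in
/-- The layer formed by the cells of `X` that satisfy `P`.  As `P` is closed only under defined
composites, `x •_k y` is taken to be `x` where the composite in `X` violates `P`. -/
noncomputable def subLayer : Layer B.toPreCat n where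
  Top := {x // P x}
  d x := X.d x.1
  c x := X.c x.1
  one a := ⟨X.one a, hone a⟩
  comp k x y := if h : P (X.comp k x.1 y.1) then ⟨_, h⟩ else x

include hcomp in
theorem isHom_subtypeVal : Layer.IsHom (X.subLayer P hone) X.toLayer Subtype.val where
  map_d _ := rfl
  map_c _ := rfl
  map_one _ := rfl
  map_comp hk x y h := congrArg Subtype.val (dif_pos (hcomp hk x.1 y.1 h x.2 y.2))

/-- The extension formed by the cells of `X` that satisfy a predicate closed under all operations.
Freeness makes its inclusion split, which gives induction on the cells of `X`. -/
noncomputable def sub : Extension B n where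
  toLayer := X.subLayer P hone
  lawful := (X.isHom_subtypeVal P hone hcomp).lawful_of_injective X.lawful Subtype.val_injective

/-- The inclusion of `X.sub P` into `X`. -/
def subInclusion : ExtHom (X.sub P hone hcomp) X where
  toFun := Subtype.val
  __ := X.isHom_subtypeVal P hone hcomp

end Sub

theorem FreelyGeneratedBy.induction (hJ : X.FreelyGeneratedBy J) {P : X.Top → Prop}
    (hgen : ∀ x ∈ J, P x) (hone : ∀ a, P (X.one a))
    (hcomp : ∀ {k} (hk : k ≤ n) x y, X.Composable hk x y → P x → P y → P (X.comp k x y))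
    (x : X.Top) : P x := by
  obtain ⟨F, hF, -⟩ := hJ (X.sub P hone hcomp) (fun x => ⟨x.1, hgen x x.2⟩) fun _ => ⟨rfl, rfl⟩
  have hid : F.trans (X.subInclusion P hone hcomp) = ExtHom.id X :=
    hJ.hom_ext fun x hx => congrArg Subtype.val (hF ⟨x, hx⟩)
  have hx : (F.toFun x).1 = x := congrArg (fun G => G.toFun x) hid
  exact hx ▸ (F.toFun x).2

end Extension

/-! ### Whiskered generators -/

namespace Layer.Lawful

variable {B : OmegaCat.{u}} {n : ℕ} {X : Layer B.toPreCat n} {k : ℕ} {x y : X.Top}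

theorem comp_comp_one (hX : X.Lawful) (hk : k < n) {a : B.cell n} (h : X.Composable le_rfl x y)
    (ha : X.Composable hk.le x (X.one a)) :
    X.comp k (X.comp n x y) (X.one a) = X.comp n (X.comp k x (X.one a)) (X.comp k y (X.one a)) := by
  rw [← hX.exchange hk le_rfl _ _ _ _ h (hX.boundaryLaws.one_composable_self a) ha,
    hX.one_comp_one_top]

theorem one_comp_comp (hX : X.Lawful) (hk : k < n) {a : B.cell n} (h : X.Composable le_rfl x y)
    (ha : X.Composable hk.le (X.one a) x) :
    X.comp k (X.one a) (X.comp n x y) = X.comp n (X.comp k (X.one a) x) (X.comp k (X.one a) y) := by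
  rw [← hX.exchange hk le_rfl _ _ _ _ (hX.boundaryLaws.one_composable_self a) h ha,
    hX.one_comp_one_top]

theorem comp_eq_comp_top (hX : X.Lawful) (hk : k < n) (h : X.Composable hk.le x y) :
    X.comp k x y = X.comp n (X.comp k x (X.one (X.c y))) (X.comp k (X.one (X.d x)) y) := by
  rw [← hX.exchange hk le_rfl _ _ _ _ (composable_top.2 (hX.c_one _).symm)
    (composable_top.2 (hX.d_one _)) (hX.boundaryLaws.composable_one_c_iff.2 h),
    hX.comp_one_top, hX.one_comp_top]

end Layer.Lawful

namespace Extension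

variable {B : OmegaCat.{u}} {n : ℕ} {I : Set (B.cell n)} {X : Extension B n} {J : Set X.Top}

/-- The cells built by `•_n` from identities and from the cells of `J` whiskered by terms. -/
inductive WhiskerGenerated (I : Set (B.cell n)) (X : Extension B n) (J : Set X.Top) : X.Top → Prop
  | one (a : B.cell n) : WhiskerGenerated I X J (X.one a)
  | whisker {w : B.cell n} (t : CTerm B n I w) (r : t.Occ) (f : X.Top) (hf : f ∈ J)
      (h : X.c f = t.label r) : WhiskerGenerated I X J (t.whisker X r f)
  | comp (x y : X.Top) (h : X.Composable le_rfl x y) (hx : WhiskerGenerated I X J x)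
      (hy : WhiskerGenerated I X J y) : WhiskerGenerated I X J (X.comp n x y)

namespace WhiskerGenerated

variable {k : ℕ} {x y : X.Top}

theorem comp_one (hT : ∀ w, Nonempty (CTerm B n I w)) (hk : k < n)
    (hx : WhiskerGenerated I X J x) {a : B.cell n} (h : X.Composable hk.le x (X.one a)) :
    WhiskerGenerated I X J (X.comp k x (X.one a)) := by
  have hX := X.lawful.boundaryLaws
  induction hx with
  | one b =>
    rw [X.lawful.one_comp_one hk b a (hX.one_composable_one_iff.1 h)]
    exact .one _
  | whisker t r f hf hr =>
    rw [hX.composable_iff_c hk, (t.whisker_dc X r f hr).2, hX.c_one] at h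
    obtain ⟨s⟩ := hT a
    exact .whisker (t.comp k hk h s) (.inl r) f hf hr
  | comp x y hxy _ _ ihx ihy =>
    have hya : X.Composable hk.le y (X.one a) :=
      (hX.dIter_d_comp_of_le hk.le le_rfl hxy).symm.trans h
    have hxa : X.Composable hk.le x (X.one a) := (hX.dIter_d_eq hk le_rfl hxy).trans hya
    rw [X.lawful.comp_comp_one hk hxy hxa]
    exact .comp _ _ (hX.composable_comp_comp_of_gt hk le_rfl hxy (hX.one_composable_self a) hxa)
      (ihx hxa) (ihy hya)

theorem one_comp (hT : ∀ w, Nonempty (CTerm B n I w)) (hk : k < n)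
    (hx : WhiskerGenerated I X J x) {a : B.cell n} (h : X.Composable hk.le (X.one a) x) :
    WhiskerGenerated I X J (X.comp k (X.one a) x) := by
  have hX := X.lawful.boundaryLaws
  induction hx with
  | one b =>
    rw [X.lawful.one_comp_one hk a b (hX.one_composable_one_iff.1 h)]
    exact .one _
  | whisker t r f hf hr =>
    rw [hX.composable_iff_c hk, (t.whisker_dc X r f hr).2, hX.c_one] at h
    obtain ⟨s⟩ := hT a
    exact .whisker (s.comp k hk h t) (.inr r) f hf hr
  | comp x y hxy _ _ ihx ihy =>
    have hax : X.Composable hk.le (X.one a) x :=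
      h.trans (hX.cIter_c_comp_of_le hk.le le_rfl hxy)
    have hay : X.Composable hk.le (X.one a) y := hax.trans (hX.cIter_c_eq hk le_rfl hxy)
    rw [X.lawful.one_comp_comp hk hxy hax]
    exact .comp _ _ (hX.composable_comp_comp_of_gt hk le_rfl (hX.one_composable_self a) hxy hax)
      (ihx hax) (ihy hay)

end WhiskerGenerated

theorem FreelyGeneratedBy.whiskerGenerated (hT : ∀ w, Nonempty (CTerm B n I w))
    (hJ : X.FreelyGeneratedBy J) (hJI : ∀ f ∈ J, X.c f ∈ I) (x : X.Top) :
    WhiskerGenerated I X J x := by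
  have hX := X.lawful.boundaryLaws
  refine hJ.induction (fun f hf => .whisker (.indet _ (hJI f hf)) () f hf rfl) .one ?_ x
  intro k hk x y h hx hy
  rcases hk.eq_or_lt with rfl | hlt
  · exact .comp x y h hx hy
  · have hxc : X.Composable hk x (X.one (X.c y)) := hX.composable_one_c_iff.2 h
    have hdy : X.Composable hk (X.one (X.d x)) y := hX.one_d_composable_iff.2 h
    rw [X.lawful.comp_eq_comp_top hlt h]
    have hx₁ : X.Composable le_rfl x (X.one (X.d x)) := Layer.composable_top.2 (hX.c_one _).symm
    have hy₁ : X.Composable le_rfl (X.one (X.c y)) y := Layer.composable_top.2 (hX.d_one _)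
    exact .comp _ _ (hX.composable_comp_comp_of_gt hlt le_rfl hx₁ hy₁ hxc)
      (hx.comp_one hT hlt hxc) (hy.one_comp hT hlt hdy)

end Extension

/-! ### Generation of the multicategory of placed composition -/

namespace Extension

variable {B : OmegaCat.{u}} {n : ℕ} {I : Set (B.cell n)} {X : Extension B n} {J : Set X.Top}

theorem WhiskerGenerated.induction_comp (hI : B.FreelyGeneratedBy n I) (O : Occurrences B n I)
    {P : X.Top → Prop}
    (hP : ∀ a r, ∀ f ∈ J, X.c f = O.label r → P a → P (X.placedComp O a r f))
    {v : X.Top} (hv : WhiskerGenerated I X J v) {a : X.Top} (hav : X.d a = X.c v) (ha : P a) :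
    P (X.comp n a v) := by
  have hX := X.lawful
  induction hv generalizing a with
  | one b =>
    rw [hX.c_one] at hav
    subst hav
    rwa [hX.comp_one_top]
  | whisker t r f hf h =>
    rw [(t.whisker_dc X r f h).2] at hav
    subst hav
    obtain ⟨χ, hχ⟩ := CTerm.exists_proves hI t (O.term (X.d a))
    rw [hχ.whisker_eq X r h]
    exact hP a (χ r) f hf (h.trans (congrArg Subtype.val (hχ.label_eq r).symm)) ha
  | comp x y hxy _ _ ihx ihy =>
    rw [hX.c_comp_top x y hxy] at hav
    have hax := Layer.composable_top.2 hav
    rw [← hX.assoc le_rfl a x y hax hxy]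
    exact ihy ((hX.d_comp_top a x hax).trans (Layer.composable_top.1 hxy)) (ihx hav ha)

theorem FreelyGeneratedBy.multicat_induction (hI : B.FreelyGeneratedBy n I)
    (O : Occurrences B n I) (hJ : X.FreelyGeneratedBy J) (hJI : ∀ f ∈ J, X.c f ∈ I)
    {P : X.ManyToOne I → Prop} (hident : ∀ x, P ((X.multicat O).ident x))
    (hcomp : ∀ a r f (hf : f ∈ J) h, P a → P ((X.multicat O).comp a r ⟨f, hJI f hf⟩ h))
    (a : X.ManyToOne I) : P a := by
  suffices h : ∃ ha, P ⟨X.comp n (X.one (X.c a.1)) a.1, ha⟩ by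
    obtain ⟨ha, h⟩ := h
    exact (Subtype.ext (X.lawful.one_comp_top a.1) : (⟨_, ha⟩ : X.ManyToOne I) = a) ▸ h
  refine (hJ.whiskerGenerated (fun w => ⟨O.term w⟩) hJI a.1).induction_comp hI O
    (P := fun x => ∃ hx, P ⟨x, hx⟩) ?_ (X.lawful.d_one _) ⟨_, hident ⟨X.c a.1, a.2⟩⟩
  rintro x r f hf h ⟨hx, hPx⟩
  exact ⟨_, hcomp ⟨x, hx⟩ r f hf (Subtype.ext h) hPx⟩

end Extension

/-! ### Morphisms of multicategories -/

namespace MulticatHom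

variable {C D : MulticatData.{u}}

/-- Two morphisms agree at an arrow: they have the same value there, and the same bijection `θ`. -/
structure AgreesAt (χ ψ : MulticatHom C D) (a : C.Arr) : Prop where
  arr_eq : χ.arr a = ψ.arr a
  theta_eq : ∀ r, (⟨_, χ.theta a r⟩ : Σ e, D.Idx e) = ⟨_, ψ.theta a r⟩

variable {χ ψ : MulticatHom C D}

theorem agreesAt_ident {x : C.Obj} (hx : χ.obj x = ψ.obj x)
    (hD : Subsingleton (D.Idx (D.ident (ψ.obj x)))) : AgreesAt χ ψ (C.ident x) := by
  have h : χ.arr (C.ident x) = ψ.arr (C.ident x) := by rw [χ.arr_ident, ψ.arr_ident, hx]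
  have hsub : Subsingleton (D.Idx (χ.arr (C.ident x))) := by rwa [h, ψ.arr_ident]
  exact ⟨h, fun r => Sigma.ext h (Subsingleton.helim (congrArg D.Idx h) _ _)⟩

theorem AgreesAt.comp {a b : C.Arr} (ha : AgreesAt χ ψ a) (hb : AgreesAt χ ψ b) (r : C.Idx a)
    (h : C.tgt b = C.typeOf (C.src a r))
    (hcover : ∀ p, (∃ q hq, C.old a r b h q hq = p) ∨ ∃ q, C.new a r b h q = p) :
    AgreesAt χ ψ (C.comp a r b h) := by
  have comp_congr : ∀ {a a' b b' r r'} (_ : (⟨a, r⟩ : Σ e, D.Idx e) = ⟨a', r'⟩) (_ : b = b') h h',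
      D.comp a r b h = D.comp a' r' b' h' := by
    rintro a _ b _ r _ ⟨⟩ rfl _ _
    rfl
  have old_congr : ∀ {a a' b b' r r' q q'} (_ : (⟨a, r⟩ : Σ e, D.Idx e) = ⟨a', r'⟩) (_ : b = b')
      (_ : (⟨a, q⟩ : Σ e, D.Idx e) = ⟨a', q'⟩) h h' hq hq',
      (⟨_, D.old a r b h q hq⟩ : Σ e, D.Idx e) = ⟨_, D.old a' r' b' h' q' hq'⟩ := by
    rintro a _ b _ r _ q _ ⟨⟩ rfl ⟨⟩ _ _ _ _
    rfl
  have new_congr : ∀ {a a' b b' r r' q q'} (_ : (⟨a, r⟩ : Σ e, D.Idx e) = ⟨a', r'⟩)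
      (_ : (⟨b, q⟩ : Σ e, D.Idx e) = ⟨b', q'⟩) h h',
      (⟨_, D.new a r b h q⟩ : Σ e, D.Idx e) = ⟨_, D.new a' r' b' h' q'⟩ := by
    rintro a _ b _ r _ q _ ⟨⟩ ⟨⟩ _ _
    rfl
  refine ⟨?_, fun p => ?_⟩
  · rw [χ.arr_comp, ψ.arr_comp]
    exact comp_congr (ha.theta_eq r) hb.arr_eq _ _
  · rcases hcover p with ⟨q, hq, rfl⟩ | ⟨q, rfl⟩
    · rw [χ.theta_old, ψ.theta_old]
      exact old_congr (ha.theta_eq r) hb.arr_eq (ha.theta_eq q) _ _ _ _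
    · rw [χ.theta_new, ψ.theta_new]
      exact new_congr (ha.theta_eq r) (hb.theta_eq q) _ _

end MulticatHom

theorem CTerm.exists_substOld_or_substNew {B : OmegaCat.{u}} {n : ℕ} {I : Set (B.cell n)}
    {w : B.cell n} (t : CTerm B n I w) (r : t.Occ) {v : B.cell n} (s : CTerm B n I v)
    (hv : B.Parallel v (t.label r)) (p : (t.subst r s hv).Occ) :
    (∃ q hq, t.substOld r s hv q hq = p) ∨ ∃ q, t.substNew r s hv q = p := by
  induction t with
  | indet => exact .inr ⟨p, rfl⟩
  | one => exact nomatch r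
  | comp k hk h t₁ t₂ ih₁ ih₂ =>
    rcases r with r | r
    · rcases p with p | p
      · rcases ih₁ r hv p with ⟨q, hq, rfl⟩ | ⟨q, rfl⟩
        · exact .inl ⟨.inl q, fun e => hq (Sum.inl.inj e), rfl⟩
        · exact .inr ⟨q, rfl⟩
      · exact .inl ⟨.inr p, Sum.inr_ne_inl, rfl⟩
    · rcases p with p | p
      · exact .inl ⟨.inl p, Sum.inl_ne_inr, rfl⟩
      · rcases ih₂ r hv p with ⟨q, hq, rfl⟩ | ⟨q, rfl⟩
        · exact .inl ⟨.inr q, fun e => hq (Sum.inr.inj e), rfl⟩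
        · exact .inr ⟨q, rfl⟩

theorem Occurrences.subsingleton_idx {B : OmegaCat.{u}} {n : ℕ} {I : Set (B.cell n)}
    (O : Occurrences B n I) (hI : B.FreelyGeneratedBy n I) {x : B.cell n} (hx : x ∈ I) :
    Subsingleton (O.Idx x) := by
  obtain ⟨χ, -⟩ := CTerm.exists_proves hI (O.term x) (.indet x hx)
  exact Equiv.subsingleton (show O.Idx x ≃ Unit from χ)

namespace Extension

variable {B : OmegaCat.{u}} {n : ℕ} {I : Set (B.cell n)} {O : Occurrences B n I}
  {X Z : Extension B n}

theorem exists_old_or_new {a b : X.ManyToOne I} {r : O.Idx (X.d a.1)}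
    (h : (X.multicat O).tgt b = (X.multicat O).typeOf ((X.multicat O).src a r))
    (p : (X.multicat O).Idx ((X.multicat O).comp a r b h)) :
    (∃ q hq, (X.multicat O).old a r b h q hq = p) ∨ ∃ q, (X.multicat O).new a r b h q = p := by
  have hl : X.c b.1 = O.label r := congrArg Subtype.val h
  have hv := X.d_parallel_label O a.1 r b.1 hl
  let e := (O.chi _ r _ hv).trans (O.castIdx (X.placedComp_dc O a.1 r b.1 hl).1.symm)
  rcases (O.term (X.d a.1)).exists_substOld_or_substNew r (O.term (X.d b.1)) hv (e.symm p) with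
    ⟨q, hq, hp⟩ | ⟨q, hp⟩
  · exact .inl ⟨q, hq, (e.eq_symm_apply).1 hp⟩
  · exact .inr ⟨q, (e.eq_symm_apply).1 hp⟩

theorem FreelyGeneratedBy.agreesAt (hI : B.FreelyGeneratedBy n I) {J : Set X.Top}
    (hJ : X.FreelyGeneratedBy J) (hJI : ∀ f ∈ J, X.c f ∈ I)
    {χ ψ : MulticatHom (X.multicat O) (Z.multicat O)} (hobj : ∀ x, χ.obj x = ψ.obj x)
    (hgen : ∀ f (hf : f ∈ J), χ.AgreesAt ψ ⟨f, hJI f hf⟩) (a : X.ManyToOne I) :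
    χ.AgreesAt ψ a := by
  refine hJ.multicat_induction hI O hJI (fun x => MulticatHom.agreesAt_ident (hobj x) ?_)
    (fun a r f hf h ha => ha.comp (hgen f hf) r h (exists_old_or_new h)) a
  change Subsingleton (O.Idx (Z.d (Z.one (ψ.obj x).1)))
  rw [Z.lawful.d_one]
  exact O.subsingleton_idx hI (ψ.obj x).2

end Extension

/-! ### Functoriality of the multicategory of placed composition -/

namespace Occurrences

variable {B : OmegaCat.{u}} {n : ℕ} {I : Set (B.cell n)} (O : Occurrences B n I)

theorem castIdx_heq {v w : B.cell n} (h : v = w) (r : O.Idx v) : HEq (O.castIdx h r) r :=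
  cast_heq _ r

theorem label_castIdx {v w : B.cell n} (h : v = w) (r : O.Idx v) :
    O.label (O.castIdx h r) = O.label r := by
  subst h
  rfl

theorem whisker_castIdx (X : Extension B n) {v w : B.cell n} (h : v = w) (r : O.Idx v)
    (x : X.Top) : (O.term w).whisker X (O.castIdx h r) x = (O.term v).whisker X r x := by
  subst h
  rfl

theorem chi_substOld_castIdx_heq {w w' v v' : B.cell n} (hw : w = w') (hv : v = v')
    {r q : O.Idx w} (p : B.Parallel v ((O.term w).label r))
    (p' : B.Parallel v' ((O.term w').label (O.castIdx hw r)))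
    (hq : q ≠ r) (hq' : O.castIdx hw q ≠ O.castIdx hw r) :
    HEq (O.chi w r v p ((O.term w).substOld r (O.term v) p q hq))
      (O.chi w' (O.castIdx hw r) v' p'
        ((O.term w').substOld (O.castIdx hw r) (O.term v') p' (O.castIdx hw q) hq')) := by
  subst hw hv
  rfl

theorem chi_substNew_castIdx_heq {w w' v v' : B.cell n} (hw : w = w') (hv : v = v')
    {r : O.Idx w} {q : O.Idx v} (p : B.Parallel v ((O.term w).label r))
    (p' : B.Parallel v' ((O.term w').label (O.castIdx hw r))) :
    HEq (O.chi w r v p ((O.term w).substNew r (O.term v) p q))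
      (O.chi w' (O.castIdx hw r) v' p'
        ((O.term w').substNew (O.castIdx hw r) (O.term v') p' (O.castIdx hv q))) := by
  subst hw hv
  rfl

end Occurrences

namespace ExtHom

variable {B : OmegaCat.{u}} {n : ℕ} {X Z : Extension B n} (F : ExtHom X Z) {I : Set (B.cell n)}

/-- The action of a functor on many-to-one cells. -/
def mapManyToOne (I : Set (B.cell n)) (a : X.ManyToOne I) : Z.ManyToOne I :=
  ⟨F.toFun a.1, (F.map_c a.1).symm ▸ a.2⟩

theorem map_whisker {w : B.cell n} (t : CTerm B n I w) (r : t.Occ) {v : X.Top}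
    (hv : X.c v = t.label r) : F.toFun (t.whisker X r v) = t.whisker Z r (F.toFun v) := by
  have hX := X.lawful.boundaryLaws
  induction t with
  | indet => rfl
  | one => exact nomatch r
  | comp k hk h t s iht ihs =>
    rcases r with r | r
    · refine (F.map_comp hk.le _ _ ?_).trans (congrArg₂ _ (iht r hv) (F.map_one _))
      rwa [hX.composable_iff_c hk, (t.whisker_dc X r v hv).2, hX.c_one]
    · refine (F.map_comp hk.le _ _ ?_).trans (congrArg₂ _ (F.map_one _) (ihs r hv))
      rwa [hX.composable_iff_c hk, (s.whisker_dc X r v hv).2, hX.c_one]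

variable (O : Occurrences B n I)

theorem map_placedComp {a b : X.Top} {r : O.Idx (X.d a)} (h : X.c b = O.label r) :
    F.toFun (X.placedComp O a r b) =
      Z.placedComp O (F.toFun a) (O.castIdx (F.map_d a).symm r) (F.toFun b) := by
  have hc : X.Composable le_rfl a ((O.term (X.d a)).whisker X r b) :=
    Layer.composable_top.2 ((O.term (X.d a)).whisker_dc X r b h).2.symm
  unfold Extension.placedComp
  rw [F.map_comp le_rfl _ _ hc, F.map_whisker _ _ h, O.whisker_castIdx]

/-- The morphism of multicategories of placed composition induced by a functor. -/
def multicatHom : MulticatHom (X.multicat O) (Z.multicat O) where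
  obj x := x
  objType x := x
  typeOf_obj _ := rfl
  arr := F.mapManyToOne I
  theta a := O.castIdx (F.map_d a.1).symm
  tgt_arr a := Subtype.ext (F.map_c a.1)
  src_arr a := O.label_castIdx (F.map_d a.1).symm
  arr_ident x := Subtype.ext (F.map_one x.1)
  arr_comp _ _ _ h := Subtype.ext (F.map_placedComp O (congrArg Subtype.val h))
  theta_old a r b h q hq := by
    refine Sigma.ext (Subtype.ext (F.map_placedComp O (congrArg Subtype.val h))) ?_
    exact ((O.castIdx_heq _ _).trans (O.castIdx_heq _ _)).trans
      ((O.chi_substOld_castIdx_heq (F.map_d a.1).symm (F.map_d b.1).symm _ _ _ _).trans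
        (O.castIdx_heq _ _).symm)
  theta_new a r b h q := by
    refine Sigma.ext (Subtype.ext (F.map_placedComp O (congrArg Subtype.val h))) ?_
    exact ((O.castIdx_heq _ _).trans (O.castIdx_heq _ _)).trans
      ((O.chi_substNew_castIdx_heq (F.map_d a.1).symm (F.map_d b.1).symm _ _).trans
        (O.castIdx_heq _ _).symm)

variable {F O} in
theorem multicatHom_agreesAt {χ : MulticatHom (X.multicat O) (Z.multicat O)} {a : X.ManyToOne I}
    (harr : F.toFun a.1 = (χ.arr a).1) {h : X.d a.1 = Z.d (χ.arr a).1}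
    (hθ : ∀ r : O.Idx (X.d a.1), χ.theta a r = O.castIdx h r) : (F.multicatHom O).AgreesAt χ a where
  arr_eq := Subtype.ext harr
  theta_eq r := Sigma.ext (Subtype.ext harr) (by
    rw [hθ r]
    exact (O.castIdx_heq (F.map_d a.1).symm r).trans (O.castIdx_heq h r).symm)

end ExtHom

/-! ### Isomorphisms -/

namespace ExtHom

variable {B : OmegaCat.{u}} {n : ℕ} {I : Set (B.cell n)} {X Z : Extension B n} {F : ExtHom X Z}

theorem isIso_of_bijective_mapManyToOne {J : Set X.Top} (hJ : X.FreelyGeneratedBy J)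
    (hJI : ∀ f ∈ J, X.c f ∈ I) {J' : Set Z.Top} (hJ' : Z.FreelyGeneratedBy J')
    (hJI' : ∀ f ∈ J', Z.c f ∈ I) (hF : Function.Bijective (F.mapManyToOne I)) : F.IsIso := by
  choose g hg using fun f : J' => hF.surjective ⟨f, hJI' f f.2⟩
  have hFg : ∀ f, F.toFun (g f).1 = f := fun f => congrArg Subtype.val (hg f)
  obtain ⟨G, hG, -⟩ := hJ' X (fun f => (g f).1) fun f =>
    ⟨by rw [← F.map_d, hFg], by rw [← F.map_c, hFg]⟩
  have hGF : G.trans F = ExtHom.id Z :=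
    hJ'.hom_ext fun f hf => (congrArg F.toFun (hG ⟨f, hf⟩)).trans (hFg ⟨f, hf⟩)
  have hFG : F.trans G = ExtHom.id X := hJ.hom_ext fun f hf => by
    have hc : X.c (G.toFun (F.toFun f)) ∈ I := by
      rw [G.map_c, F.map_c]
      exact hJI f hf
    exact congrArg Subtype.val (hF.injective (a₁ := ⟨_, hc⟩) (a₂ := ⟨f, hJI f hf⟩)
      (Subtype.ext (congrArg (fun H => H.toFun (F.toFun f)) hGF)))
  exact ⟨G, fun x => congrArg (fun H => H.toFun x) hFG, fun z => congrArg (fun H => H.toFun z) hGF⟩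

end ExtHom

end Computad

theorem corollaryL (B : Computad.OmegaCat.{u}) (n : ℕ) (I : Set (B.cell n))
    (hI : B.FreelyGeneratedBy n I) (O : Computad.Occurrences B n I)
    (X : Computad.Extension B n) (J : Set X.Top) (hJ : X.FreelyGeneratedBy J)
    (hJI : ∀ f ∈ J, X.c f ∈ I)
    (Z : Computad.Extension B n) (χ : Computad.MulticatHom (X.multicat O) (Z.multicat O))
    (hobj : ∀ x : I, χ.obj x = x)
    (hd : ∀ (f : X.Top) (hf : f ∈ J), X.d f = Z.d (χ.arr ⟨f, hJI f hf⟩).1)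
    (hc : ∀ (f : X.Top) (hf : f ∈ J), Z.c (χ.arr ⟨f, hJI f hf⟩).1 = X.c f)
    (hθ : ∀ (f : X.Top) (hf : f ∈ J) (r : O.Idx (X.d f)),
      χ.theta ⟨f, hJI f hf⟩ r = O.castIdx (hd f hf) r) :
    (∃! F : Computad.ExtHom X Z, ∀ a : X.ManyToOne I, F.toFun a.1 = (χ.arr a).1) ∧
    (∀ J' : Set Z.Top, Z.FreelyGeneratedBy J' → (∀ f ∈ J', Z.c f ∈ I) → χ.IsIso →
      ∀ F : Computad.ExtHom X Z, (∀ a : X.ManyToOne I, F.toFun a.1 = (χ.arr a).1) → F.IsIso) := by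
  obtain ⟨F, hF, -⟩ := hJ Z (fun f => (χ.arr ⟨f, hJI f f.2⟩).1)
    (fun f => ⟨(hd f f.2).symm, hc f f.2⟩)
  refine ⟨⟨F, fun a => ?_, fun G hG => ?_⟩, fun J' hJ' hJI' hχ G hG => ?_⟩
  · have hgen : ∀ f (hf : f ∈ J), (F.multicatHom O).AgreesAt χ ⟨f, hJI f hf⟩ := fun f hf =>
      Computad.ExtHom.multicatHom_agreesAt (hF ⟨f, hf⟩) (hθ f hf)
    exact congrArg Subtype.val (hJ.agreesAt hI hJI (fun x => (hobj x).symm) hgen a).arr_eq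
  · exact hJ.hom_ext fun f hf => (hG ⟨f, hJI f hf⟩).trans (hF ⟨f, hf⟩).symm
  · obtain ⟨ψ, -, -, -, -, hψχ, hχψ⟩ := hχ
    have hmap : G.mapManyToOne I = χ.arr := funext fun a => Subtype.ext (hG a)
    refine Computad.ExtHom.isIso_of_bijective_mapManyToOne hJ hJI hJ' hJI' ?_
    rw [hmap]
    exact ⟨Function.LeftInverse.injective hψχ, Function.RightInverse.surjective hχψ⟩
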